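/- Let $G=(V,E,\omega)$ be a finite, simple, connected, undirected graph with $V=\{1,\dots,n\}$ and symmetric weights, $\omega_{ij}>0$ if $(i,j)\in E$ (ordered pairs) and $\omega_{ij}=0$ otherwise; $N(i)$ is the set of neighbours of $i$. Let $\mathcal P(G)=\{\rho\in\mathbb R^n:\rho_i\ge 0,\ \sum_i\rho_i=1\}$, let $\mathcal P_0(G)$ be the set of those $\rho\in\mathcal P(G)$ with all $\rho_i>0$, and let $\mathbb S^{n\times n}$ be the real skew-symmetric matrices. Let $g:[0,1]^2\to[0,\infty)$ be continuous, $C^\infty$ on $(0,1)^2$, symmetric, concave, positively $1$-homogeneous ($g(\lambda s,\lambda t)=\lambda g(s,t)$ for $\lambda>0$ when both points lie in $[0,1]^2$), with $\min\{s,t\}\le g(s,t)\le\max\{s,t\}$. Put $$(\nabla_G\varphi)_{ij}=\sqrt{\omega_{ij}}(\varphi_i-\varphi_j),\quad (\mathrm{div}_\rho v)_i=\sum_{j\in N(i)}\sqrt{\omega_{ij}}\,g(\rho_i,\rho_j)v_{ji},\quad (v,w)_\rho=\tfrac12\sum_{(i,j)\in E}g(\rho_i,\rho_j)v_{ij}w_{ij},\quad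 \|v\|_\rho^2=(v,v)_\rho .$$ Let $T_\rho$ be the set of $v\in\mathbb S^{n\times n}$ that are limits of graph gradients $\nabla_G\varphi_l$ in $\|\cdot\|_\rho$. Let $\mathcal W(\rho,\rho')^2$ be the infimum of $\int_0^1\|v(t)\|_{\sigma(t)}^2dt$ over $\sigma\in C([0,1],\mathcal P(G))$ and Borel $v:[0,1]\to\mathbb S^{n\times n}$ such that all $g(\sigma_i,\sigma_j)v_{ij}$, $(i,j)\in E$, are integrable, $\dot\sigma+\mathrm{div}_\sigma(v)=0$ in the sense of distributions, $\sigma(0)=\rho$ and $\sigma(1)=\rho'$. A function $F:\mathcal P(G)\to\mathbb R$ has Fréchet derivative $f=\frac{\delta F}{\delta\rho}(\rho)$ at $\rho\in\mathcal P(G)$ if $\sum_i f_i=0$ and $\lim_{t\to0^+}\frac1t\big(F((1-t)\rho+t\rho')-F(\rho)\big)=\sum_i f_i(\rho'_i-\rho_i)$ for all $\rho'\in\mathcal P(G)$; $F$ is Fréchet continuously differentiable if this derivative exists at every point of $\mathcal P(G)$ and is continuous on $\mathcal P(G)$. A matrix $v\in T_\rho$ is a Wasserstein gradient $\nabla_{\mathcal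 W}F(\rho)$ if there is $c>0$ such that for every $\varepsilon>0$ there is $\delta>0$ with $$|F(\rho')-F(\rho)-(v,v')_\rho|\le\varepsilon\,\mathcal W(\rho,\rho')+c\,\|\rho'-\rho+\mathrm{div}_\rho(v')\|_{\ell_1}\quad\text{for all }\rho'\in\mathcal P(G),\ v'\in T_\rho\text{ with }\|\rho'-\rho\|_{\ell_1}<\delta .$$ Assume that $g(s,t)=0$ whenever $st=0$; that $\bar g(s,t)=(\log s-\log t)\,g(s,t)$, defined for $s,t\in(0,1]$, extends continuously to $[0,1]^2$ (the extension is again called $\bar g$); and that the resulting extension $\xi$ of $\mu\mapsto\mathrm{div}_\mu(\nabla_G\log\mu)$ to $\mathcal P(G)$, $\xi_i(\mu)=\sum_{j\in N(i)}\omega_{ij}\bar g(\mu_j,\mu_i)$, is Lipschitz and of class $C^1$ on $\mathcal P(G)$. Then for every $\mu\in\mathcal P(G)$ the problem $\dot\sigma=\xi(\sigma)$, $\sigma(0)=\mu$ has a solution $\sigma^\mu:[0,\infty)\to\mathcal P(G)$, which is unique on every interval $[0,T]$ among solutions with values in $\mathcal P(G)$. Moreover, if $u_0:\mathcal P(G)\to\mathbb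 R$ is Fréchet continuously differentiable and $u(t,\mu)=u_0(\sigma^\mu(t))$, then: (i) $u$ is continuously differentiable: $\partial_tu(t,\mu)$ (one-sided at $t=0$) and the Fréchet derivative $\frac{\delta u}{\delta\mu}(t,\mu)$ exist for all $(t,\mu)\in[0,\infty)\times\mathcal P(G)$ and are jointly continuous there. (ii) $u(0,\cdot)=u_0$, and $\partial_tu(t,\mu)=\Delta_{\mathrm{ind}}u(t,\mu)$ for all $t\ge0$ and $\mu\in\mathcal P(G)$. Here $\Delta_{\mathrm{ind}}u(t,\mu)=\mathcal O_\mu(\nabla_{\mathcal W}u(t,\mu))$, where $p=\nabla_G\frac{\delta u}{\delta\mu}(t,\mu)$ is a Wasserstein gradient of $u(t,\cdot)$ at $\mu$ and $$\mathcal O_\mu(p)=-\tfrac12\sum_{(i,j)\in E}\sqrt{\omega_{ij}}\,\bar g(\mu_i,\mu_j)\,p_{ij}.$$ For $\mu\in\mathcal P_0(G)$ one has $\mathcal O_\mu(p)=\sum_i(\mathrm{div}_\mu p)_i\log\mu_i=-(p,\nabla_G\log\mu)_\mu$, and the equation then holds with any Wasserstein gradient $p$ of $u(t,\cdot)$ at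 $\mu$. -/

import Mathlib

open Set Filter Topology MeasureTheory
open scoped ENNReal ContDiff

noncomputable section

namespace GraphHJ

/-- A finite simple connected undirected graph on the vertices `Fin n` together with a symmetric
weight which is positive exactly on the edges. -/
structure WeightedGraph (n : ℕ) where
  graph : SimpleGraph (Fin n)
  weight : Fin n → Fin n → ℝ
  connected : graph.Connected
  weight_symm : ∀ i j, weight i j = weight j i
  weight_pos : ∀ i j, graph.Adj i j → 0 < weight i j
  weight_zero : ∀ i j, ¬ graph.Adj i j → weight i j = 0

/-- The standing properties of a metric tensor `g : [0,1] × [0,1] → [0,∞)`; only the values of `g`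
on the unit square matter. -/
structure IsMetricTensor (g : ℝ → ℝ → ℝ) : Prop where
  continuousOn : ContinuousOn (Function.uncurry g) (Icc 0 1 ×ˢ Icc 0 1)
  smooth : ContDiffOn ℝ ∞ (Function.uncurry g) (Ioo 0 1 ×ˢ Ioo 0 1)
  symm : ∀ s ∈ Icc (0 : ℝ) 1, ∀ t ∈ Icc (0 : ℝ) 1, g s t = g t s
  concave : ConcaveOn ℝ (Icc (0 : ℝ) 1 ×ˢ Icc (0 : ℝ) 1) (Function.uncurry g)
  homogeneous : ∀ c : ℝ, 0 < c → ∀ s ∈ Icc (0 : ℝ) 1, ∀ t ∈ Icc (0 : ℝ) 1,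
    c * s ≤ 1 → c * t ≤ 1 → g (c * s) (c * t) = c * g s t
  min_le : ∀ s ∈ Icc (0 : ℝ) 1, ∀ t ∈ Icc (0 : ℝ) 1, min s t ≤ g s t
  le_max : ∀ s ∈ Icc (0 : ℝ) 1, ∀ t ∈ Icc (0 : ℝ) 1, g s t ≤ max s t

variable {n : ℕ}

/-- The probability vectors on the graph. -/
abbrev Prob (n : ℕ) : Set (Fin n → ℝ) := stdSimplex ℝ (Fin n)

/-- The probability vectors all of whose entries are positive. -/
def PosProb (n : ℕ) : Set (Fin n → ℝ) := {ρ | ρ ∈ Prob n ∧ ∀ i, 0 < ρ i}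

def l1Norm (x : Fin n → ℝ) : ℝ := ∑ i, |x i|

def IsSkew (v : Matrix (Fin n) (Fin n) ℝ) : Prop := v.transpose = -v

/-- The graph gradient `(∇_G φ)_{ij} = √ω_{ij} (φ_i - φ_j)`. -/
def grad (Γ : WeightedGraph n) (φ : Fin n → ℝ) : Matrix (Fin n) (Fin n) ℝ :=
  Matrix.of fun i j => √(Γ.weight i j) * (φ i - φ j)

open Classical in
/-- The graph divergence `(div_ρ v)_i = ∑_{j ∈ N(i)} √ω_{ij} g(ρ_i, ρ_j) v_{ji}`. -/
def div (Γ : WeightedGraph n) (g : ℝ → ℝ → ℝ) (ρ : Fin n → ℝ) (v : Matrix (Fin n) (Fin n) ℝ) :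
    Fin n → ℝ :=
  fun i => ∑ j with Γ.graph.Adj i j, √(Γ.weight i j) * g (ρ i) (ρ j) * v j i

open Classical in
/-- The graph inner product `(v, w)_ρ = ½ ∑_{(i,j) ∈ E} g(ρ_i, ρ_j) v_{ij} w_{ij}`, the sum being
over ordered pairs. -/
def gInner (Γ : WeightedGraph n) (g : ℝ → ℝ → ℝ) (ρ : Fin n → ℝ)
    (v w : Matrix (Fin n) (Fin n) ℝ) : ℝ :=
  (1 / 2) * ∑ i, ∑ j with Γ.graph.Adj i j, g (ρ i) (ρ j) * v i j * w i j

/-- The graph norm. -/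
def gNorm (Γ : WeightedGraph n) (g : ℝ → ℝ → ℝ) (ρ : Fin n → ℝ)
    (v : Matrix (Fin n) (Fin n) ℝ) : ℝ :=
  √(gInner Γ g ρ v v)

/-- `v` belongs to the tangent space at `ρ`: it is a limit of graph gradients in `‖·‖_ρ`. -/
def IsTangent (Γ : WeightedGraph n) (g : ℝ → ℝ → ℝ) (ρ : Fin n → ℝ)
    (v : Matrix (Fin n) (Fin n) ℝ) : Prop :=
  IsSkew v ∧ ∃ φ : ℕ → Fin n → ℝ, Tendsto (fun l => gNorm Γ g ρ (v - grad Γ (φ l))) atTop (𝓝 0)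

/-- `(σ, v)` joins `ρ₀` to `ρ₁` in unit time and `σ̇ + div_σ(v) = 0` in the sense of
distributions, with `σ` continuous in the probability vectors and `v` Borel. -/
structure IsAdmissible (Γ : WeightedGraph n) (g : ℝ → ℝ → ℝ) (ρ₀ ρ₁ : Fin n → ℝ)
    (σ : ℝ → Fin n → ℝ) (v : ℝ → Matrix (Fin n) (Fin n) ℝ) : Prop where
  continuousOn : ContinuousOn σ (Icc 0 1)
  mem : ∀ t ∈ Icc (0 : ℝ) 1, σ t ∈ Prob n
  skew : ∀ t, IsSkew (v t)
  measurable : ∀ i j, Measurable fun t => v t i j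
  integrable : ∀ i j, Γ.graph.Adj i j →
    IntegrableOn (fun t => g (σ t i) (σ t j) * v t i j) (Icc 0 1)
  start : σ 0 = ρ₀
  finish : σ 1 = ρ₁
  continuity : ∀ φ : ℝ → Fin n → ℝ, ContDiff ℝ 1 φ →
    (∑ i, φ 1 i * σ 1 i) - (∑ i, φ 0 i * σ 0 i)
      - ∫ t in (0 : ℝ)..1, ((∑ i, deriv φ t i * σ t i) + gInner Γ g (σ t) (grad Γ (φ t)) (v t)) = 0

/-- The Wasserstein distance: the square root of the infimum of `∫₀¹ ‖v‖²_σ dt`. -/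
def wasserstein (Γ : WeightedGraph n) (g : ℝ → ℝ → ℝ) (ρ₀ ρ₁ : Fin n → ℝ) : ℝ≥0∞ :=
  (⨅ (σ : ℝ → Fin n → ℝ) (v : ℝ → Matrix (Fin n) (Fin n) ℝ) (_ : IsAdmissible Γ g ρ₀ ρ₁ σ v),
    ∫⁻ t in Icc (0 : ℝ) 1, ENNReal.ofReal (gNorm Γ g (σ t) (v t) ^ 2)) ^ (1 / 2 : ℝ)

/-- `f` is the Fréchet derivative at `ρ` of a function `F` on the probability vectors. (Only
`t > 0` is possible for a general `ρ'`, since `F` is a function on the simplex.) -/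
def HasFrechetDeriv (F : (Fin n → ℝ) → ℝ) (f ρ : Fin n → ℝ) : Prop :=
  ∑ i, f i = 0 ∧ ∀ ρ' ∈ Prob n,
    Tendsto (fun t : ℝ => (F ((1 - t) • ρ + t • ρ') - F ρ) / t) (𝓝[>] 0)
      (𝓝 (∑ i, f i * (ρ' i - ρ i)))

/-- `F` is Fréchet continuously differentiable on the probability vectors. -/
def FrechetC1 (F : (Fin n → ℝ) → ℝ) : Prop :=
  ∃ f : (Fin n → ℝ) → Fin n → ℝ, ContinuousOn f (Prob n) ∧
    ∀ ρ ∈ Prob n, HasFrechetDeriv F (f ρ) ρ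

/-- `v` is a Wasserstein gradient of `F` at `ρ`. -/
def IsWassersteinGradient (Γ : WeightedGraph n) (g : ℝ → ℝ → ℝ) (F : (Fin n → ℝ) → ℝ)
    (ρ : Fin n → ℝ) (v : Matrix (Fin n) (Fin n) ℝ) : Prop :=
  IsTangent Γ g ρ v ∧ ∃ c : ℝ, 0 < c ∧ ∀ ε : ℝ, 0 < ε → ∃ δ : ℝ, 0 < δ ∧
    ∀ ρ' ∈ Prob n, ∀ v' : Matrix (Fin n) (Fin n) ℝ, IsTangent Γ g ρ v' → l1Norm (ρ' - ρ) < δ →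
      ENNReal.ofReal |F ρ' - F ρ - gInner Γ g ρ v v'| ≤
        ENNReal.ofReal ε * wasserstein Γ g ρ ρ'
          + ENNReal.ofReal (c * l1Norm (ρ' - ρ + div Γ g ρ v'))

/-- `ḡ(s,t) = (log s - log t) g(s,t)` for `s, t ∈ (0,1]`, extended to the closed unit square by
taking limits. -/
def gBar (g : ℝ → ℝ → ℝ) (s t : ℝ) : ℝ :=
  extendFrom (Ioc (0 : ℝ) 1 ×ˢ Ioc (0 : ℝ) 1)
    (fun q : ℝ × ℝ => (Real.log q.1 - Real.log q.2) * g q.1 q.2) (s, t)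

open Classical in
/-- The extension `ξ` of `μ ↦ div_μ(∇_G log μ)` to all probability vectors,
`ξ_i(μ) = ∑_{j ∈ N(i)} ω_{ij} ḡ(μ_j, μ_i)`. -/
def xi (Γ : WeightedGraph n) (g : ℝ → ℝ → ℝ) (μ : Fin n → ℝ) : Fin n → ℝ :=
  fun i => ∑ j with Γ.graph.Adj i j, Γ.weight i j * gBar g (μ j) (μ i)

/-- The individual noise operator `O_μ(p) = (div_μ(p), log μ)`, for positive `μ`. -/
def noise (Γ : WeightedGraph n) (g : ℝ → ℝ → ℝ) (μ : Fin n → ℝ) (p : Matrix (Fin n) (Fin n) ℝ) :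
    ℝ :=
  ∑ i, div Γ g μ p i * Real.log (μ i)

open Classical in
/-- The individual noise operator extended to all `μ`: one has `O_μ(p) = -(p, ∇_G log μ)_μ`, in
which `g(μ_i, μ_j) (log μ_i - log μ_j)` is read as `ḡ(μ_i, μ_j)`. -/
def noiseExt (Γ : WeightedGraph n) (g : ℝ → ℝ → ℝ) (μ : Fin n → ℝ)
    (p : Matrix (Fin n) (Fin n) ℝ) : ℝ :=
  -((1 / 2) * ∑ i, ∑ j with Γ.graph.Adj i j,
      √(Γ.weight i j) * gBar g (μ i) (μ j) * p i j)

/-- `s` solves `ṡ = ξ(s)`, `s(0) = μ` on the time interval `I` within the probability vectors. -/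
structure IsSolution (Γ : WeightedGraph n) (g : ℝ → ℝ → ℝ) (I : Set ℝ) (μ : Fin n → ℝ)
    (s : ℝ → Fin n → ℝ) : Prop where
  mem : ∀ t ∈ I, s t ∈ Prob n
  initial : s 0 = μ
  ode : ∀ t ∈ I, HasDerivWithinAt s (xi Γ g (s t)) I t

/-- `u` is continuously differentiable on `[0,∞) × P(G)`, with time derivative `ut` and Fréchet
derivative `Du` in the probability vector. -/
structure IsC1With (u : ℝ → (Fin n → ℝ) → ℝ) (ut : ℝ → (Fin n → ℝ) → ℝ)
    (Du : ℝ → (Fin n → ℝ) → Fin n → ℝ) : Prop where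
  hasDeriv : ∀ t ∈ Ici (0 : ℝ), ∀ μ ∈ Prob n,
    HasDerivWithinAt (fun r => u r μ) (ut t μ) (Ici 0) t
  hasFrechetDeriv : ∀ t ∈ Ici (0 : ℝ), ∀ μ ∈ Prob n, HasFrechetDeriv (u t) (Du t μ) μ
  continuousOn_time : ContinuousOn (Function.uncurry ut) (Ici 0 ×ˢ Prob n)
  continuousOn_space : ContinuousOn (Function.uncurry Du) (Ici 0 ×ˢ Prob n)

end GraphHJ

end

open GraphHJ

/-! Write σ_t for the flow of ξ. The equation is the flow property in disguise: u(t+r, μ) = u(t, σ_r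
μ), and differentiating at r = 0 gives ∂_t u(t, μ) = ∑ f_i ξ_i(μ), where f is the Fréchet derivative
of u(t, ·) at μ. Since ḡ is antisymmetric and ω symmetric, summation by parts turns this sum into
O_μ(∇_G f) (`noiseExt_grad`).

The flow exists because ξ_i ≥ 0 where μ_i = 0. With the Lipschitz bound this gives ξ_i ≥ -K μ_i, so
a short Euler step stays in the simplex (`add_smul_xi_mem`), and a Gronwall argument for the
distance to the simplex confines the solutions of an extended field
(`mem_of_hasDerivWithinAt_of_inward`).

The simplex has empty interior and derivatives at its boundary are one-sided, so differentiability
in μ is expressed by increment factors in the manner of Hadamard: f(b) - f(a) = G(a,b)(b - a) with G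
continuous. Both ξ and u₀ have such factors, obtained by averaging derivatives along segments
(`exists_continuous_increment_factor`). The difference of two trajectories then solves a linear
equation with coefficient G(σ_s a, σ_s b), hence equals a jointly continuous fundamental solution
applied to b - a (`exists_flow_increment_factor`). Composing with the factor of u₀ gives one for
u(t, ·), and its diagonal values represent the Fréchet derivative.

The same factor produces the Wasserstein gradient, because div is the negative adjoint of ∇_G and 𝒲
dominates the ℓ¹ distance (`isWassersteinGradient_grad`). At a positive μ, moving by -s div_μ(∇_G φ)
costs 𝒲 = O(s), so all Wasserstein gradients have the same inner product with ∇_G φ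
(`gInner_eq_of_isWassersteinGradient`). The choice φ = log μ gives the last claim. -/

/-! ### Hadamard's lemma on convex sets with one-sided derivatives. -/

section Analysis

variable {E F : Type*} [NormedAddCommGroup E] [NormedSpace ℝ E]
  [NormedAddCommGroup F] [NormedSpace ℝ F]

/-- A continuous map on a compact set with values in a finite-dimensional space extends to a bounded
continuous map. -/
theorem exists_bounded_continuous_extension {X V : Type} [TopologicalSpace X]
    [NormalSpace X] [T2Space X] [NormedAddCommGroup V] [NormedSpace ℝ V] [FiniteDimensional ℝ V]
    {P : Set X} (hP : IsCompact P) {f : X → V} (hf : ContinuousOn f P) :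
    ∃ g : X → V, ∃ C : ℝ, Continuous g ∧ (∀ x, ‖g x‖ ≤ C) ∧ EqOn g f P := by
  have : TietzeExtension.{0, 0} V := TietzeExtension.of_tvs ℝ
  obtain ⟨g, hg⟩ := ContinuousMap.exists_restrict_eq hP.isClosed
    (⟨P.domRestrict f, hf.domRestrict⟩ : C(P, V))
  have hgf : EqOn g f P := fun x hx => congrArg (fun h : C(P, V) => h ⟨x, hx⟩) hg
  obtain ⟨C, hC⟩ := hP.exists_bound_of_continuousOn hf
  set C' := max C 1
  have hC' : 0 < C' := lt_of_lt_of_le one_pos (le_max_right _ _)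
  have hpos : ∀ x, 0 < max C' ‖g x‖ := fun x => lt_of_lt_of_le hC' (le_max_left _ _)
  -- Radial retraction onto the ball of radius `C'`, which fixes the values taken on `P`. The lower
  -- bound 1 on `C'` keeps the denominators positive even if `C` is not.
  refine ⟨fun x => (C' / max C' ‖g x‖) • g x, C', ?_, fun x => ?_, fun x hx => ?_⟩
  · exact (continuous_const.div (continuous_const.max g.continuous.norm)
      fun x => (hpos x).ne').smul g.continuous
  · rw [norm_smul, Real.norm_of_nonneg (div_nonneg hC'.le (hpos x).le), div_mul_eq_mul_div,
      div_le_iff₀ (hpos x)]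
    exact mul_le_mul_of_nonneg_left (le_max_right _ _) hC'.le
  · have h1 : ‖g x‖ ≤ C' := by
      rw [hgf hx]; exact (hC x hx).trans (le_max_left _ _)
    change (C' / max C' ‖g x‖) • g x = f x
    rw [max_eq_left h1, div_self hC'.ne', one_smul, hgf hx]

/-- One-sided directional derivatives along a segment combine to a derivative along the segment. -/
theorem hasDerivWithinAt_comp_segment {P : Set E} (hP : Convex ℝ P) {D : E → E →L[ℝ] F}
    {f : E → F} (hf : ∀ x ∈ P, ∀ y ∈ P,
      HasDerivWithinAt (fun t : ℝ => f (x + t • (y - x))) (D x (y - x)) (Icc 0 1) 0)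
    {a b : E} (ha : a ∈ P) (hb : b ∈ P) {τ : ℝ} (hτ : τ ∈ Icc (0 : ℝ) 1) :
    HasDerivWithinAt (fun t : ℝ => f (a + t • (b - a))) (D (a + τ • (b - a)) (b - a))
      (Icc 0 1) τ := by
  set x := a + τ • (b - a) with hx
  have hxP : x ∈ P := hP.add_smul_sub_mem ha hb hτ
  -- The hypothesis differentiates only at the start of a segment. The stretch from τ to r is the
  -- segment from `x` to a + r(b - a), traversed at speed 1/(r - τ), and linearity of `D x` cancels
  -- that speed. Taking r = 0 and r = 1 covers both sides of τ.
  have key : ∀ r ∈ Icc (0 : ℝ) 1, r ≠ τ →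
      HasDerivWithinAt (fun t : ℝ => f (a + t • (b - a))) (D x (b - a)) (uIcc τ r) τ := by
    intro r hr hrτ
    have hne : r - τ ≠ 0 := sub_ne_zero.2 hrτ
    have h1 := hf x hxP (a + r • (b - a)) (hP.add_smul_sub_mem ha hb hr)
    have e1 : a + r • (b - a) - x = (r - τ) • (b - a) := by rw [hx, sub_smul]; abel
    rw [e1] at h1
    have h2 : HasDerivWithinAt (fun s : ℝ => (s - τ) / (r - τ)) (1 / (r - τ)) (uIcc τ r) τ :=
      (((hasDerivAt_id τ).sub_const τ).div_const (r - τ)).hasDerivWithinAt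
    have hmaps : MapsTo (fun s : ℝ => (s - τ) / (r - τ)) (uIcc τ r) (Icc 0 1) := by
      intro s hs
      rcases lt_or_gt_of_ne hrτ with h | h
      · rw [uIcc_of_ge h.le] at hs
        exact ⟨div_nonneg_of_nonpos (by linarith [hs.2]) (by linarith),
          (div_le_one_of_neg (by linarith)).2 (by linarith [hs.1])⟩
      · rw [uIcc_of_le h.le] at hs
        exact ⟨div_nonneg (by linarith [hs.1]) (by linarith),
          (div_le_one (by linarith)).2 (by linarith [hs.2])⟩
    have h0 : (τ - τ) / (r - τ) = 0 := by simp
    have h3 := HasDerivWithinAt.scomp_of_eq τ h1 h2 hmaps h0.symm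
    have e2 : (1 / (r - τ)) • D x ((r - τ) • (b - a)) = D x (b - a) := by
      rw [map_smul, smul_smul, one_div_mul_cancel hne, one_smul]
    rw [e2] at h3
    refine h3.congr_of_eventuallyEq (Eventually.of_forall fun s => ?_) ?_
    · simp only [Function.comp, smul_smul, div_mul_cancel₀ _ hne]
      rw [hx, add_assoc, ← add_smul, add_sub_cancel]
    · simp only [Function.comp, smul_smul, div_mul_cancel₀ _ hne]
      rw [hx, add_assoc, ← add_smul, add_sub_cancel]
  rcases eq_or_lt_of_le hτ.1 with h0 | h0
  · have := key 1 ⟨zero_le_one, le_rfl⟩ (by rw [← h0]; norm_num)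
    rw [← h0] at this ⊢
    rwa [uIcc_of_le zero_le_one] at this
  rcases eq_or_lt_of_le hτ.2 with h1 | h1
  · have := key 0 ⟨le_rfl, zero_le_one⟩ (by rw [h1]; norm_num)
    rw [h1] at this ⊢
    rwa [uIcc_of_ge zero_le_one] at this
  have := (key 0 ⟨le_rfl, zero_le_one⟩ h0.ne).union (key 1 ⟨zero_le_one, le_rfl⟩ h1.ne')
  rwa [uIcc_of_ge h0.le, uIcc_of_le h1.le, Icc_union_Icc_eq_Icc h0.le h1.le] at this

/-- Hadamard's lemma on a convex set: the increment of a map with a continuous directional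
derivative is a continuous linear factor applied to the increment of the variable. -/
theorem exists_continuous_increment_factor [CompleteSpace F] [LocallyCompactSpace E]
    {P : Set E} (hP : Convex ℝ P)
    {D : E → E →L[ℝ] F} (hD : Continuous D) {C : ℝ} (hC : ∀ x, ‖D x‖ ≤ C) {f : E → F}
    (hf : ∀ x ∈ P, ∀ y ∈ P,
      HasDerivWithinAt (fun t : ℝ => f (x + t • (y - x))) (D x (y - x)) (Icc 0 1) 0) :
    ∃ G : E × E → E →L[ℝ] F, Continuous G ∧ (∀ p, ‖G p‖ ≤ C) ∧ (∀ a, G (a, a) = D a) ∧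
      ∀ a ∈ P, ∀ b ∈ P, f b - f a = G (a, b) (b - a) := by
  -- The factor is the average of `D` along the segment. As `D` is continuous and bounded
  -- everywhere, so is the average, and not only on P × P.
  refine ⟨fun p => ∫ τ in (0 : ℝ)..1, D (p.1 + τ • (p.2 - p.1)), ?_, fun p => ?_, fun a => ?_,
    fun a ha b hb => ?_⟩
  · apply intervalIntegral.continuous_parametric_intervalIntegral_of_continuous'
    unfold Function.uncurry
    fun_prop
  · simpa using intervalIntegral.norm_integral_le_of_norm_le_const (a := 0) (b := 1)
      (f := fun τ : ℝ => D (p.1 + τ • (p.2 - p.1))) (fun τ _ => hC _)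
  · simp
  · have hc : Continuous fun τ : ℝ => D (a + τ • (b - a)) := by fun_prop
    rw [ContinuousLinearMap.intervalIntegral_apply (hc.intervalIntegrable _ _)]
    have hd := fun τ hτ => hasDerivWithinAt_comp_segment hP hf ha hb (τ := τ) hτ
    have := intervalIntegral.integral_eq_sub_of_hasDerivAt_of_le zero_le_one
      (fun τ hτ => (hd τ hτ).continuousWithinAt)
      (fun τ hτ => (hd τ (Ioo_subset_Icc_self hτ)).hasDerivAt (Icc_mem_nhds hτ.1 hτ.2))
      ((hc.clm_apply continuous_const).intervalIntegrable _ _)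
    simpa using this.symm

end Analysis

/-! ### Linear equations with a parameter, by the Picard series. -/

section LinearODE

variable {X A : Type*} [TopologicalSpace X]
  [NormedRing A] [NormedAlgebra ℝ A]

/-- The Picard iterates `∫₀ᵗ B ∫₀ˢ B ⋯` of the linear equation `Φ' = B Φ`, `Φ(0) = 1`. -/
noncomputable def picardTerm (B : X → ℝ → A) : ℕ → X → ℝ → A
  | 0 => fun _ _ => 1
  | k + 1 => fun p t => ∫ s in (0 : ℝ)..t, B p s * picardTerm B k p s

theorem continuous_picardTerm {B : X → ℝ → A} (hB : Continuous (Function.uncurry B)) (k : ℕ) :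
    Continuous (Function.uncurry (picardTerm B k)) := by
  induction k with
  | zero => exact continuous_const
  | succ k ih =>
    have : Continuous fun q : X × ℝ => ∫ s in (0 : ℝ)..q.2,
        (fun (x : X × ℝ) s => B x.1 s * picardTerm B k x.1 s) q s := by
      apply intervalIntegral.continuous_parametric_intervalIntegral_of_continuous _ continuous_snd
      have e : Continuous fun x : (X × ℝ) × ℝ => (x.1.1, x.2) := by fun_prop
      exact (hB.comp e).mul (ih.comp e)
    exact this

theorem hasDerivAt_picardTerm_succ [CompleteSpace A] {B : X → ℝ → A} (hB : Continuous (Function.uncurry B))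
    (k : ℕ) (p : X) (t : ℝ) :
    HasDerivAt (picardTerm B (k + 1) p) (B p t * picardTerm B k p t) t := by
  have e : Continuous fun s : ℝ => (p, s) := by fun_prop
  have hc : Continuous fun s => B p s * picardTerm B k p s :=
    (hB.comp e).mul ((continuous_picardTerm hB k).comp e)
  exact (hc.integral_hasStrictDerivAt 0 t).hasDerivAt

/-- Each integration turns |s|^k / k! into |t|^(k+1) / (k+1)!. The factor ‖1‖ is kept because it
need not be 1: it vanishes for the operators on the zero space. -/
theorem norm_picardTerm_le {B : X → ℝ → A} (hB : Continuous (Function.uncurry B)) {C : ℝ}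
    (hC : ∀ p t, ‖B p t‖ ≤ C) (k : ℕ) (p : X) (t : ℝ) :
    ‖picardTerm B k p t‖ ≤ ‖(1 : A)‖ * (C ^ k * |t| ^ k / k.factorial) := by
  have hC0 : 0 ≤ C := (norm_nonneg _).trans (hC p t)
  induction k generalizing t with
  | zero => simp [picardTerm]
  | succ k ih =>
    have e : Continuous fun s : ℝ => (p, s) := by fun_prop
    calc ‖picardTerm B (k + 1) p t‖
        ≤ ∫ s in uIoc 0 t, ‖B p s * picardTerm B k p s‖ :=
          intervalIntegral.norm_integral_le_integral_norm_uIoc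
      _ ≤ ∫ s in uIoc 0 t, (C * ‖(1 : A)‖ * C ^ k / k.factorial) * |s - 0| ^ k := by
          refine setIntegral_mono_on ?_ ?_ measurableSet_uIoc fun s _ => ?_
          · exact (((hB.comp e).mul ((continuous_picardTerm hB k).comp e)).norm.intervalIntegrable
              0 t).def'
          · have : Continuous fun s : ℝ =>
              (C * ‖(1 : A)‖ * C ^ k / k.factorial) * |s - 0| ^ k := by fun_prop
            exact (this.intervalIntegrable 0 t).def'
          · calc ‖B p s * picardTerm B k p s‖ ≤ ‖B p s‖ * ‖picardTerm B k p s‖ := norm_mul_le _ _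
              _ ≤ C * (‖(1 : A)‖ * (C ^ k * |s| ^ k / k.factorial)) :=
                mul_le_mul (hC p s) (ih s) (norm_nonneg _) hC0
              _ = _ := by rw [sub_zero]; ring
      _ = _ := by
          rw [integral_const_mul, integral_pow_abs_sub_uIoc, sub_zero, Nat.factorial_succ]
          push_cast
          field_simp
          ring

/-- A linear differential equation whose coefficient depends continuously on a parameter has a
fundamental solution that is jointly continuous in the parameter and the time. -/
theorem exists_fundamental_solution [CompleteSpace A] {B : X → ℝ → A} (hB : Continuous (Function.uncurry B)) {C : ℝ}
    (hC : ∀ p t, ‖B p t‖ ≤ C) :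
    ∃ Φ : X → ℝ → A, Continuous (Function.uncurry Φ) ∧ (∀ p, Φ p 0 = 1) ∧
      ∀ p t, HasDerivAt (Φ p) (B p t * Φ p t) t := by
  have hs : ∀ T : ℝ, Summable fun k : ℕ => ‖(1 : A)‖ * (C ^ k * T ^ k / k.factorial) := fun T => by
    simp_rw [← mul_pow]
    exact (Real.summable_pow_div_factorial _).mul_left _
  have hle : ∀ (T : ℝ) (k : ℕ) (p : X) (t : ℝ), t ∈ Ioo (-T) T →
      ‖picardTerm B k p t‖ ≤ ‖(1 : A)‖ * (C ^ k * T ^ k / k.factorial) := by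
    intro T k p t ht
    have hC0 : 0 ≤ C := (norm_nonneg _).trans (hC p t)
    refine (norm_picardTerm_le hB hC k p t).trans ?_
    have : |t| ≤ T := (abs_lt.2 ht).le
    gcongr
  have hsum : ∀ p t, Summable fun k => picardTerm B k p t := fun p t =>
    Summable.of_norm_bounded (hs (|t| + 1)) fun k => hle _ k p t
      (abs_lt.1 (lt_add_one _))
  refine ⟨fun p t => ∑' k, picardTerm B k p t, ?_, fun p => ?_, fun p t => ?_⟩
  · rw [continuous_iff_continuousAt]
    rintro ⟨p, t⟩
    have hmem : (univ : Set X) ×ˢ Ioo (-(|t| + 1)) (|t| + 1) ∈ 𝓝 (p, t) :=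
      prod_mem_nhds univ_mem (isOpen_Ioo.mem_nhds (abs_lt.1 (lt_add_one _)))
    refine ContinuousOn.continuousAt (s := univ ×ˢ Ioo (-(|t| + 1)) (|t| + 1)) ?_ hmem
    exact continuousOn_tsum (fun k => (continuous_picardTerm hB k).continuousOn) (hs (|t| + 1))
      fun k q hq => hle _ k q.1 q.2 hq.2
  · change ∑' k, picardTerm B k p 0 = 1
    rw [(hsum p 0).tsum_eq_zero_add]
    simp [picardTerm]
  · set T := |t| + 1
    have htT : t ∈ Ioo (-T) T := abs_lt.1 (lt_add_one _)
    -- Term k + 1 has derivative `B` times term k, so the differentiated tail is `B` times the whole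
    -- series. The constant term is added back afterwards.
    have h1 : HasDerivAt (fun s => ∑' k, picardTerm B (k + 1) p s)
        (∑' k, B p t * picardTerm B k p t) t := by
      refine hasDerivAt_tsum_of_isPreconnected ((hs T).mul_left C) isOpen_Ioo isPreconnected_Ioo
        (fun k s _ => hasDerivAt_picardTerm_succ hB k p s) (fun k s hs' => ?_) htT
        ((summable_nat_add_iff 1).2 (hsum p t)) htT
      exact (norm_mul_le _ _).trans (mul_le_mul (hC p s) (hle T k p s hs') (norm_nonneg _)
        ((norm_nonneg _).trans (hC p s)))
    rw [(hsum p t).tsum_mul_left] at h1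
    have e : (fun s => ∑' k, picardTerm B k p s) =
        fun s => (1 : A) + ∑' k, picardTerm B (k + 1) p s := by
      funext s
      rw [(hsum p s).tsum_eq_zero_add]
      rfl
    change HasDerivAt (fun s => ∑' k, picardTerm B k p s) (B p t * ∑' k, picardTerm B k p t) t
    rw [e]
    exact h1.const_add 1

end LinearODE

/-! ### Invariance of a compact convex set and existence of the flow. -/

section Flow

variable {E : Type*} [NormedAddCommGroup E] [NormedSpace ℝ E]

/-- A differentiable curve whose velocity is a Lipschitz field pointing inward on a compact convex
set does not leave this set. -/
theorem mem_of_hasDerivWithinAt_of_inward {P : Set E} (hP : IsCompact P) (hPc : Convex ℝ P)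
    {v : E → E} {K : NNReal} (hv : LipschitzWith K v) {h : ℝ} (hh : 0 < h)
    (hin : ∀ x ∈ P, x + h • v x ∈ P) {T : ℝ} {s : ℝ → E} (hs0 : s 0 ∈ P)
    (hs : ∀ t ∈ Icc 0 T, HasDerivWithinAt s (v (s t)) (Icc 0 T) t) :
    ∀ t ∈ Icc 0 T, s t ∈ P := by
  have hne : P.Nonempty := ⟨_, hs0⟩
  have hcont : ContinuousOn s (Icc 0 T) := fun t ht => (hs t ht).continuousWithinAt
  -- The distance d to `P` starts at 0 and has lower right derivative at most K d, so it stays 0.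
  have hgr := le_gronwallBound_of_liminf_deriv_right_le (f := fun t => Metric.infDist (s t) P)
    (f' := fun t => K * Metric.infDist (s t) P) (δ := 0) (K := K) (ε := 0) (a := 0) (b := T)
    ((Metric.continuous_infDist_pt P).comp_continuousOn hcont) ?_
    (by rw [Metric.infDist_zero_of_mem hs0]) (fun x _ => by simp)
  · intro t ht
    have := hgr t ht
    rw [gronwallBound_ε0_δ0] at this
    exact (hP.isClosed.mem_iff_infDist_zero hne).2 (le_antisymm this Metric.infDist_nonneg)
  · intro t ht r hr
    obtain ⟨p, hpP, hp⟩ := hP.exists_infDist_eq_dist hne (s t)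
    have hd : HasDerivWithinAt s (v (s t)) (Ioi t) t :=
      (hs t (Ico_subset_Icc_self ht)).mono_of_mem_nhdsWithin
        (mem_of_superset (Ioc_mem_nhdsGT ht.2) fun z hz => ⟨ht.1.trans hz.1.le, hz.2⟩)
    have hlim := (hasDerivWithinAt_iff_tendsto_slope' self_notMem_Ioi).1 hd
    have hlim' : Tendsto (fun z => ‖slope s t z - v (s t)‖) (𝓝[>] t) (𝓝 0) := by
      simpa using (hlim.sub_const (v (s t))).norm
    have h1 := hlim'.eventually_lt_const (sub_pos.2 hr)
    have h2 : Ioc t (t + h) ∈ 𝓝[>] t := Ioc_mem_nhdsGT (by linarith)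
    refine (h1.and h2).frequently.mono fun z hz => ?_
    obtain ⟨hz1, hz2⟩ := hz
    have hz0 : 0 < z - t := sub_pos.2 hz2.1
    -- An Euler step of length at most h from the nearest point `p` stays in `P` by convexity, so it
    -- bounds the distance at time z from above.
    have hq : p + (z - t) • v p ∈ P := by
      have hmem := hPc.add_smul_sub_mem hpP (hin p hpP)
        (t := (z - t) / h) ⟨by positivity, (div_le_one hh).2 (by linarith [hz2.2])⟩
      rwa [add_sub_cancel_left, smul_smul, div_mul_cancel₀ _ hh.ne'] at hmem
    have hslope : s z - s t = (z - t) • slope s t z := by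
      rw [slope_def_module, smul_smul, mul_inv_cancel₀ hz0.ne', one_smul]
    have hle : Metric.infDist (s z) P ≤
        dist (s t) p + (z - t) * (‖slope s t z - v (s t)‖ + K * dist (s t) p) := by
      refine (Metric.infDist_le_dist_of_mem hq).trans ?_
      rw [dist_eq_norm, show s z - (p + (z - t) • v p) =
        (s t - p) + (z - t) • ((slope s t z - v (s t)) + (v (s t) - v p)) by
          rw [smul_add, smul_sub, smul_sub, ← hslope]; abel]
      refine (norm_add_le _ _).trans ?_
      rw [norm_smul, Real.norm_of_nonneg hz0.le, ← dist_eq_norm (s t) p]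
      have := hv.dist_le_mul (s t) p
      gcongr
      exact (norm_add_le _ _).trans (by rw [← dist_eq_norm (v (s t))]; gcongr)
    rw [inv_mul_lt_iff₀ hz0]
    change Metric.infDist (s z) P - Metric.infDist (s t) P < _
    rw [← hp] at hle
    have := mul_lt_mul_of_pos_left hz1 hz0
    nlinarith

/-- Solutions within a set on which the field is Lipschitz depend on the initial value in a
Lipschitz way. -/
theorem dist_solution_le {P : Set E} {v : E → E} {K : NNReal}
    (hv : LipschitzOnWith K v P) {T : ℝ} {r s : ℝ → E} (hrP : ∀ t ∈ Icc 0 T, r t ∈ P)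
    (hsP : ∀ t ∈ Icc 0 T, s t ∈ P)
    (hr : ∀ t ∈ Icc 0 T, HasDerivWithinAt r (v (r t)) (Icc 0 T) t)
    (hs : ∀ t ∈ Icc 0 T, HasDerivWithinAt s (v (s t)) (Icc 0 T) t) :
    ∀ t ∈ Icc 0 T, dist (r t) (s t) ≤ dist (r 0) (s 0) * Real.exp (K * t) := by
  have hmem : ∀ t ∈ Ico 0 T, Icc 0 T ∈ 𝓝[≥] t := fun t ht =>
    mem_of_superset (Icc_mem_nhdsGE ht.2) (Icc_subset_Icc_left ht.1)
  intro t ht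
  have := dist_le_of_trajectories_ODE_of_mem (v := fun _ => v) (s := fun _ => P) (fun _ _ => hv)
    (fun t ht => (hr t ht).continuousWithinAt)
    (fun t ht => (hr t (Ico_subset_Icc_self ht)).mono_of_mem_nhdsWithin (hmem t ht))
    (fun t ht => hrP t (Ico_subset_Icc_self ht))
    (fun t ht => (hs t ht).continuousWithinAt)
    (fun t ht => (hs t (Ico_subset_Icc_self ht)).mono_of_mem_nhdsWithin (hmem t ht))
    (fun t ht => hsP t (Ico_subset_Icc_self ht)) le_rfl t ht
  rwa [sub_zero] at this

/-- A Lipschitz field on a compact set of vectors extends to a bounded Lipschitz field. -/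
theorem exists_bounded_lipschitz_extension {ι : Type*} [Fintype ι] {P : Set (ι → ℝ)}
    (hP : IsCompact P) {v : (ι → ℝ) → ι → ℝ} {K : NNReal} (hv : LipschitzOnWith K v P) :
    ∃ w : (ι → ℝ) → ι → ℝ, ∃ C : NNReal, LipschitzWith K w ∧ (∀ x, ‖w x‖ ≤ C) ∧ EqOn w v P := by
  obtain ⟨w, hw, hwv⟩ := hv.extend_pi
  obtain ⟨C, hC⟩ := hP.exists_bound_of_continuousOn hv.continuousOn
  have hcc : -max C 0 ≤ max C 0 := neg_le_self (le_max_right _ _)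
  -- Truncating each coordinate does not increase Lipschitz constants in the sup norm.
  refine ⟨fun x i => projIcc (-max C 0) (max C 0) hcc (w x i), ⟨max C 0, le_max_right _ _⟩,
    ?_, fun x => ?_, fun x hx => ?_⟩
  · refine LipschitzWith.of_dist_le_mul fun x y => (dist_pi_le_iff (by positivity)).2 fun i => ?_
    have h1 := (LipschitzWith.projIcc hcc).dist_le_mul (w x i) (w y i)
    rw [NNReal.coe_one, one_mul] at h1
    exact h1.trans ((dist_le_pi_dist _ _ i).trans (hw.dist_le_mul x y))
  · refine (pi_norm_le_iff_of_nonneg (le_max_right _ _)).2 fun i => ?_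
    exact abs_le.2 (projIcc (-max C 0) (max C 0) hcc (w x i)).2
  · funext i
    have : w x i ∈ Icc (-max C 0) (max C 0) := by
      rw [← hwv hx]
      exact abs_le.1 ((norm_le_pi_norm (v x) i).trans ((hC x hx).trans (le_max_left _ _)))
    change (projIcc (-max C 0) (max C 0) hcc (w x i) : ℝ) = v x i
    rw [projIcc_of_mem _ this, hwv hx]

/-- A Lipschitz field pointing inward on a compact convex set has a flow on this set, for all
positive times. -/
theorem exists_flow_of_inward {ι : Type*} [Fintype ι] {P : Set (ι → ℝ)}
    (hP : IsCompact P) (hPc : Convex ℝ P) {v : (ι → ℝ) → ι → ℝ} {K : NNReal}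
    (hv : LipschitzOnWith K v P) {h : ℝ} (hh : 0 < h) (hin : ∀ x ∈ P, x + h • v x ∈ P) :
    ∃ σ : ℝ → (ι → ℝ) → ι → ℝ, ∀ x ∈ P, σ 0 x = x ∧ (∀ t ∈ Ici (0 : ℝ), σ t x ∈ P) ∧
      ∀ t ∈ Ici (0 : ℝ), HasDerivWithinAt (fun r => σ r x) (v (σ t x)) (Ici 0) t := by
  obtain ⟨w, C, hw, hwC, hwv⟩ := exists_bounded_lipschitz_extension hP hv
  have hex : ∀ x : ι → ℝ, ∀ T : ℝ, ∃ s : ℝ → ι → ℝ, x ∈ P → s 0 = x ∧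
      (∀ t ∈ Icc 0 T, s t ∈ P) ∧
      ∀ t ∈ Icc 0 T, HasDerivWithinAt s (v (s t)) (Icc 0 T) t := by
    intro x T
    rcases lt_or_ge T 0 with hT | hT
    · exact ⟨fun _ => x, fun _ => ⟨rfl, by simp [Icc_eq_empty_of_lt hT]⟩⟩
    -- A field bounded by `C` cannot leave the ball of radius C T before time T, so one application
    -- covers all of [0, T].
    have hPL : IsPicardLindelof (fun _ => w) (⟨0, le_rfl, hT⟩ : Icc 0 T) x
        (C * ⟨T, hT⟩) 0 C K :=
      { lipschitzOnWith := fun _ _ => hw.lipschitzOnWith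
        continuousOn := fun _ _ => continuousOn_const
        norm_le := fun _ _ y _ => hwC y
        mul_max_le := by
          simp only [sub_zero, sub_self, max_eq_left hT, NNReal.coe_zero]
          exact le_rfl }
    obtain ⟨s, hs0, hs⟩ := hPL.exists_eq_forall_mem_Icc_hasDerivWithinAt₀
    refine ⟨s, fun hx => ?_⟩
    have hsP := mem_of_hasDerivWithinAt_of_inward hP hPc hw hh
      (fun y hy => by rw [hwv hy]; exact hin y hy) (by rw [hs0]; exact hx) hs
    exact ⟨hs0, hsP, fun t ht => by rw [← hwv (hsP t ht)]; exact hs t ht⟩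
  choose s hs using hex
  -- The solutions on different intervals agree by uniqueness. The extra unit of time puts t
  -- strictly before the right end, so that a derivative within [0, ∞) is available there.
  refine ⟨fun t x => s x (t + 1) t, fun x hx => ?_⟩
  have heq : ∀ T : ℝ, ∀ t ∈ Icc 0 T, s x (t + 1) t = s x T t := by
    intro T t ht
    obtain ⟨h1, h2, h3⟩ := hs x (t + 1) hx
    obtain ⟨k1, k2, k3⟩ := hs x T hx
    have s1 : Icc 0 t ⊆ Icc 0 (t + 1) := Icc_subset_Icc_right (by linarith)
    have s2 : Icc 0 t ⊆ Icc 0 T := Icc_subset_Icc_right ht.2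
    have := dist_solution_le hv (fun r hr => h2 r (s1 hr)) (fun r hr => k2 r (s2 hr))
      (fun r hr => (h3 r (s1 hr)).mono s1) (fun r hr => (k3 r (s2 hr)).mono s2) t ⟨ht.1, le_rfl⟩
    rw [h1, k1, dist_self, zero_mul] at this
    exact dist_le_zero.1 this
  refine ⟨(hs x _ hx).1, fun t ht => (hs x _ hx).2.1 t ⟨ht, by linarith⟩, fun t ht => ?_⟩
  have h1 := (hs x (t + 1) hx).2.2 t ⟨ht, by linarith⟩
  have h2 : HasDerivWithinAt (s x (t + 1)) (v (s x (t + 1) t)) (Ici 0) t := by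
    refine h1.mono_of_mem_nhdsWithin ?_
    rw [mem_nhdsWithin]
    exact ⟨Iio (t + 1), isOpen_Iio, by simp, fun z hz => ⟨hz.2, (mem_Iio.1 hz.1).le⟩⟩
  refine h2.congr_of_eventuallyEq ?_ rfl
  filter_upwards [self_mem_nhdsWithin, mem_nhdsWithin_of_mem_nhds
    (isOpen_Iio.mem_nhds (show t ∈ Iio (t + 1) by simp))] with z hz1 hz2
  exact heq (t + 1) z ⟨hz1, (mem_Iio.1 hz2).le⟩

end Flow

/-! ### Dependence of the flow on the initial value. -/

section FlowDerivative

variable {E F : Type*} [NormedAddCommGroup E] [NormedSpace ℝ E]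
  [NormedAddCommGroup F] [NormedSpace ℝ F]

/-- A function whose increment is a continuous linear factor applied to the increment of a
differentiable curve is differentiable. -/
theorem hasDerivWithinAt_of_increment_factor {S : Set ℝ} {t : ℝ} {c : ℝ → E} {c' : E}
    (hc : HasDerivWithinAt c c' S t) {f : ℝ → F} {L : ℝ → E →L[ℝ] F}
    (hL : ContinuousWithinAt L S t) (hf : ∀ r ∈ S, f r - f t = L r (c r - c t)) :
    HasDerivWithinAt f (L t c') S t := by
  rw [hasDerivWithinAt_iff_tendsto_slope] at hc ⊢
  have h1 : Tendsto (fun r => L r (slope c t r)) (𝓝[S \ {t}] t) (𝓝 (L t c')) :=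
    (isBoundedBilinearMap_apply (𝕜 := ℝ)).continuous.tendsto (L t, c') |>.comp
      (Tendsto.prodMk_nhds (hL.mono sdiff_subset) hc)
  refine h1.congr' ?_
  filter_upwards [self_mem_nhdsWithin] with r hr
  rw [slope_def_module, slope_def_module, map_smul, hf r hr.1]

variable {P : Set E} {v : E → E} {K : NNReal} {σ : ℝ → E → E}

/-- The flow property of the solutions of an autonomous equation. -/
theorem flow_add (hv : LipschitzOnWith K v P)
    (hσ : ∀ x ∈ P, σ 0 x = x ∧ (∀ t ∈ Ici (0 : ℝ), σ t x ∈ P) ∧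
      ∀ t ∈ Ici (0 : ℝ), HasDerivWithinAt (fun r => σ r x) (v (σ t x)) (Ici 0) t)
    {x : E} (hx : x ∈ P) {t r : ℝ} (ht : 0 ≤ t) (hr : 0 ≤ r) : σ (r + t) x = σ t (σ r x) := by
  obtain ⟨h1, h2, h3⟩ := hσ x hx
  obtain ⟨k1, k2, k3⟩ := hσ (σ r x) (h2 r hr)
  have hd : ∀ s ∈ Icc 0 t,
      HasDerivWithinAt (fun s => σ (r + s) x) (v (σ (r + s) x)) (Icc 0 t) s := by
    intro s hs
    have e : HasDerivWithinAt (fun s => r + s) 1 (Icc 0 t) s :=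
      ((hasDerivAt_id s).const_add r).hasDerivWithinAt
    have := (h3 (r + s) (add_nonneg hr hs.1)).scomp s e
      (fun q hq => add_nonneg hr hq.1)
    rwa [one_smul] at this
  have := dist_solution_le hv (r := fun s => σ (r + s) x) (s := fun s => σ s (σ r x)) (T := t)
    (fun s hs => h2 _ (add_nonneg hr hs.1)) (fun s hs => k2 s hs.1) hd
    (fun s hs => (k3 s hs.1).mono Icc_subset_Ici_self) t ⟨ht, le_rfl⟩
  simp only [add_zero, k1, dist_self, zero_mul] at this
  exact dist_le_zero.1 this

/-- At a fixed time the flow is Lipschitz in x by Gronwall. In time it is Lipschitz with a constant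
independent of x, a bound for `v` on `P`. Together these give joint continuity. -/
theorem continuousOn_flow (hP : IsCompact P) (hv : LipschitzOnWith K v P)
    (hσ : ∀ x ∈ P, σ 0 x = x ∧ (∀ t ∈ Ici (0 : ℝ), σ t x ∈ P) ∧
      ∀ t ∈ Ici (0 : ℝ), HasDerivWithinAt (fun r => σ r x) (v (σ t x)) (Ici 0) t) :
    ContinuousOn (Function.uncurry σ) (Ici 0 ×ˢ P) := by
  obtain ⟨C, hC⟩ := hP.exists_bound_of_continuousOn hv.continuousOn
  refine continuousOn_prod_of_continuousOn_lipschitzOnWith _ C.toNNReal (fun t ht => ?_)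
    fun x hx => ?_
  · refine LipschitzOnWith.continuousOn (K := (Real.exp (K * t)).toNNReal) ?_
    refine LipschitzOnWith.of_dist_le_mul fun x hx y hy => ?_
    have := dist_solution_le hv (T := t) (fun s hs => (hσ x hx).2.1 s hs.1)
      (fun s hs => (hσ y hy).2.1 s hs.1)
      (fun s hs => ((hσ x hx).2.2 s hs.1).mono Icc_subset_Ici_self)
      (fun s hs => ((hσ y hy).2.2 s hs.1).mono Icc_subset_Ici_self) t ⟨ht, le_rfl⟩
    simp only [(hσ x hx).1, (hσ y hy).1] at this
    rw [Real.coe_toNNReal _ (Real.exp_pos _).le, mul_comm]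
    exact this
  · refine LipschitzOnWith.of_dist_le_mul fun s hs t ht => ?_
    rw [dist_eq_norm, dist_eq_norm]
    exact (convex_Ici (0 : ℝ)).norm_image_sub_le_of_norm_hasDerivWithin_le (hσ x hx).2.2
      (fun r hr => (hC _ ((hσ x hx).2.1 r hr)).trans (Real.le_coe_toNNReal C)) ht hs

/-- The flow, stopped at the initial value for negative times, is jointly continuous. -/
theorem continuous_flow_max (hP : IsCompact P) (hv : LipschitzOnWith K v P)
    (hσ : ∀ x ∈ P, σ 0 x = x ∧ (∀ t ∈ Ici (0 : ℝ), σ t x ∈ P) ∧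
      ∀ t ∈ Ici (0 : ℝ), HasDerivWithinAt (fun r => σ r x) (v (σ t x)) (Ici 0) t)
    {X : Type*} [TopologicalSpace X] {π : X → P} (hπ : Continuous π) :
    Continuous fun q : X × ℝ => σ (max q.2 0) (π q.1) :=
  (continuousOn_flow hP hv hσ).comp_continuous
    (f := fun q : X × ℝ => (max q.2 0, (π q.1 : E)))
    (by fun_prop) fun q => ⟨mem_Ici.2 (le_max_right _ _), (π q.1).2⟩

/-- The increment of the flow of a field `v` is a continuous linear factor applied to the increment
of the initial value, if this is true of `v` itself. -/
theorem exists_flow_increment_factor [CompleteSpace E] (hP : IsCompact P)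
    (hv : LipschitzOnWith K v P)
    (hσ : ∀ x ∈ P, σ 0 x = x ∧ (∀ t ∈ Ici (0 : ℝ), σ t x ∈ P) ∧
      ∀ t ∈ Ici (0 : ℝ), HasDerivWithinAt (fun r => σ r x) (v (σ t x)) (Ici 0) t)
    {G : E × E → E →L[ℝ] E} (hG : Continuous G) {C : ℝ} (hC : ∀ p, ‖G p‖ ≤ C)
    (hvG : ∀ a ∈ P, ∀ b ∈ P, v b - v a = G (a, b) (b - a)) :
    ∃ Φ : P × P → ℝ → E →L[ℝ] E, Continuous (Function.uncurry Φ) ∧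
      ∀ a b : P, ∀ t ∈ Ici (0 : ℝ), σ t b - σ t a = Φ (a, b) t (b - a) := by
  -- Stopping the flow at negative times makes the coefficient continuous and bounded on all of ℝ;
  -- nothing changes for t ≥ 0.
  have hB : Continuous (Function.uncurry fun (p : P × P) (t : ℝ) =>
      G (σ (max t 0) p.1, σ (max t 0) p.2)) :=
    hG.comp ((continuous_flow_max hP hv hσ continuous_fst).prodMk (continuous_flow_max hP hv hσ continuous_snd))
  obtain ⟨Φ, hΦ, hΦ0, hΦd⟩ := exists_fundamental_solution hB fun p t => hC _
  refine ⟨Φ, hΦ, fun a b t ht => ?_⟩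
  -- Both the difference of trajectories and Φ(b - a) solve the linear equation with initial value b
  -- - a; their difference solves it from 0 and vanishes by Gronwall.
  have hz : ∀ s ∈ Ici (0 : ℝ), HasDerivWithinAt
      (fun s => σ s b - σ s a - Φ (a, b) s (b - a))
      (G (σ s a, σ s b) (σ s b - σ s a - Φ (a, b) s (b - a))) (Ici 0) s := by
    intro s hs
    have h1 := (((hσ b b.2).2.2 s hs).sub ((hσ a a.2).2.2 s hs)).sub
      (((hΦd (a, b) s).clm_apply (hasDerivAt_const s ((b : E) - a))).hasDerivWithinAt (s := Ici 0))
    convert! h1 using 1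
    rw [hvG _ ((hσ a a.2).2.1 s hs) _ ((hσ b b.2).2.1 s hs), map_sub]
    simp only [max_eq_left hs.out, map_zero, add_zero]
    rfl
  have := eq_zero_of_abs_deriv_le_mul_abs_self_of_eq_zero_right (a := 0) (b := t) (K := C)
    (fun s hs => (hz s hs.1).continuousWithinAt.mono Icc_subset_Ici_self)
    (fun s hs => (hz s hs.1).mono (Ici_subset_Ici.2 hs.1))
    (by rw [(hσ b b.2).1, (hσ a a.2).1, hΦ0]; exact sub_self _)
    (fun s hs => ((G _).le_opNorm _).trans (mul_le_mul_of_nonneg_right (hC _) (norm_nonneg _)))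
    t ⟨ht, le_rfl⟩
  exact sub_eq_zero.1 this

/-- A function with a continuous increment factor, composed with the flow, has an increment factor
that is jointly continuous in the time and the initial values. -/
theorem exists_comp_flow_increment_factor [CompleteSpace E] (hP : IsCompact P)
    (hv : LipschitzOnWith K v P)
    (hσ : ∀ x ∈ P, σ 0 x = x ∧ (∀ t ∈ Ici (0 : ℝ), σ t x ∈ P) ∧
      ∀ t ∈ Ici (0 : ℝ), HasDerivWithinAt (fun r => σ r x) (v (σ t x)) (Ici 0) t)
    {G : E × E → E →L[ℝ] E} (hG : Continuous G) {C : ℝ} (hC : ∀ p, ‖G p‖ ≤ C)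
    (hvG : ∀ a ∈ P, ∀ b ∈ P, v b - v a = G (a, b) (b - a))
    {f : E → F} {D : E × E → E →L[ℝ] F} (hD : Continuous D)
    (hfD : ∀ a ∈ P, ∀ b ∈ P, f b - f a = D (a, b) (b - a)) :
    ∃ H : P × P → ℝ → E →L[ℝ] F, Continuous (Function.uncurry H) ∧
      ∀ a b : P, ∀ t ∈ Ici (0 : ℝ), f (σ t b) - f (σ t a) = H (a, b) t (b - a) := by
  obtain ⟨Φ, hΦ, hΦσ⟩ := exists_flow_increment_factor hP hv hσ hG hC hvG
  refine ⟨fun p t => (D (σ (max t 0) p.1, σ (max t 0) p.2)).comp (Φ p t), ?_,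
    fun a b t ht => ?_⟩
  · exact (hD.comp ((continuous_flow_max hP hv hσ continuous_fst).prodMk (continuous_flow_max hP hv hσ continuous_snd))).clm_comp hΦ
  · rw [hfD _ ((hσ a a.2).2.1 t ht) _ ((hσ b b.2).2.1 t ht), hΦσ a b t ht]
    simp only [max_eq_left ht.out]
    rfl

end FlowDerivative

/-! ### Antisymmetry and sign of ḡ on the closed square. -/

section MetricTensor

theorem GraphHJ.IsMetricTensor.nonneg {g : ℝ → ℝ → ℝ} (hg : IsMetricTensor g) {s t : ℝ}
    (hs : s ∈ Icc (0 : ℝ) 1) (ht : t ∈ Icc (0 : ℝ) 1) : 0 ≤ g s t :=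
  (le_min hs.1 ht.1).trans (hg.min_le s hs t ht)

theorem GraphHJ.IsMetricTensor.le_one {g : ℝ → ℝ → ℝ} (hg : IsMetricTensor g) {s t : ℝ}
    (hs : s ∈ Icc (0 : ℝ) 1) (ht : t ∈ Icc (0 : ℝ) 1) : g s t ≤ 1 :=
  (hg.le_max s hs t ht).trans (max_le hs.2 ht.2)

theorem gBar_of_pos {g : ℝ → ℝ → ℝ} (hg : IsMetricTensor g) {s t : ℝ}
    (hs : s ∈ Ioc (0 : ℝ) 1) (ht : t ∈ Ioc (0 : ℝ) 1) :
    gBar g s t = (Real.log s - Real.log t) * g s t := by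
  have hc : ContinuousOn (fun q : ℝ × ℝ => (Real.log q.1 - Real.log q.2) * g q.1 q.2)
      (Ioc (0 : ℝ) 1 ×ˢ Ioc (0 : ℝ) 1) := by
    refine ContinuousOn.mul (ContinuousOn.sub ?_ ?_)
      (hg.continuousOn.mono (prod_mono Ioc_subset_Icc_self Ioc_subset_Icc_self))
    · exact continuousOn_fst.log fun q hq => hq.1.1.ne'
    · exact continuousOn_snd.log fun q hq => hq.2.1.ne'
  exact extendFrom_extends hc (s, t) ⟨hs, ht⟩

/-- The values of `gBar` on the unit square are limits of its values at positive arguments. -/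
theorem tendsto_gBar_max {g : ℝ → ℝ → ℝ}
    (hgBar : ContinuousOn (Function.uncurry (gBar g)) (Icc 0 1 ×ˢ Icc 0 1)) {s t : ℝ}
    (hs : s ∈ Icc (0 : ℝ) 1) (ht : t ∈ Icc (0 : ℝ) 1) :
    Tendsto (fun ε => gBar g (max s ε) (max t ε)) (𝓝[Ioc 0 1] 0) (𝓝 (gBar g s t)) := by
  have h1 : Tendsto (fun ε : ℝ => (max s ε, max t ε)) (𝓝[Ioc 0 1] 0) (𝓝 (s, t)) := by
    have hc : Continuous fun ε : ℝ => (max s ε, max t ε) := by fun_prop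
    have := hc.tendsto 0
    simp only [max_eq_left hs.1, max_eq_left ht.1] at this
    exact this.mono_left nhdsWithin_le_nhds
  have h2 : Tendsto (fun ε : ℝ => (max s ε, max t ε)) (𝓝[Ioc 0 1] 0)
      (𝓝[Icc 0 1 ×ˢ Icc 0 1] (s, t)) := by
    refine tendsto_nhdsWithin_iff.2 ⟨h1, ?_⟩
    filter_upwards [self_mem_nhdsWithin] with ε hε
    exact mk_mem_prod ⟨le_max_of_le_left hs.1, max_le hs.2 hε.2⟩ ⟨le_max_of_le_left ht.1, max_le ht.2 hε.2⟩
  have h3 : Tendsto (Function.uncurry (gBar g)) (𝓝[Icc 0 1 ×ˢ Icc 0 1] (s, t))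
      (𝓝 (Function.uncurry (gBar g) (s, t))) := hgBar (s, t) (mk_mem_prod hs ht)
  rw [Function.uncurry_apply_pair] at h3
  refine (h3.comp h2).congr fun ε => ?_
  rw [Function.comp_apply, Function.uncurry_apply_pair]

theorem nhdsWithin_Ioc_zero_one_neBot : (𝓝[Ioc (0 : ℝ) 1] 0).NeBot := by
  rw [nhdsWithin_Ioc_eq_nhdsGT one_pos]
  infer_instance

/-- Clear from the symmetry of `g` at positive arguments; the boundary follows by replacing both
arguments by their maximum with ε and letting ε → 0. -/
theorem gBar_swap {g : ℝ → ℝ → ℝ} (hg : IsMetricTensor g)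
    (hgBar : ContinuousOn (Function.uncurry (gBar g)) (Icc 0 1 ×ˢ Icc 0 1)) {s t : ℝ}
    (hs : s ∈ Icc (0 : ℝ) 1) (ht : t ∈ Icc (0 : ℝ) 1) : gBar g t s = -gBar g s t := by
  have := nhdsWithin_Ioc_zero_one_neBot
  refine tendsto_nhds_unique_of_eventuallyEq (tendsto_gBar_max hgBar ht hs)
    (tendsto_gBar_max hgBar hs ht).neg ?_
  filter_upwards [self_mem_nhdsWithin] with ε hε
  have h1 : max s ε ∈ Ioc (0 : ℝ) 1 := ⟨lt_max_of_lt_right hε.1, max_le hs.2 hε.2⟩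
  have h2 : max t ε ∈ Ioc (0 : ℝ) 1 := ⟨lt_max_of_lt_right hε.1, max_le ht.2 hε.2⟩
  rw [gBar_of_pos hg h1 h2, gBar_of_pos hg h2 h1,
    hg.symm _ (Ioc_subset_Icc_self h1) _ (Ioc_subset_Icc_self h2)]
  ring

/-- The same limit: taking maxima with ε preserves the order of the arguments, and log is monotone.
-/
theorem gBar_nonneg {g : ℝ → ℝ → ℝ} (hg : IsMetricTensor g)
    (hgBar : ContinuousOn (Function.uncurry (gBar g)) (Icc 0 1 ×ˢ Icc 0 1)) {s t : ℝ}
    (hs : s ∈ Icc (0 : ℝ) 1) (ht : t ∈ Icc (0 : ℝ) 1) (hts : t ≤ s) : 0 ≤ gBar g s t := by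
  have := nhdsWithin_Ioc_zero_one_neBot
  refine ge_of_tendsto (tendsto_gBar_max hgBar hs ht) ?_
  filter_upwards [self_mem_nhdsWithin] with ε hε
  have h1 : max s ε ∈ Ioc (0 : ℝ) 1 := ⟨lt_max_of_lt_right hε.1, max_le hs.2 hε.2⟩
  have h2 : max t ε ∈ Ioc (0 : ℝ) 1 := ⟨lt_max_of_lt_right hε.1, max_le ht.2 hε.2⟩
  rw [gBar_of_pos hg h1 h2]
  exact mul_nonneg (sub_nonneg.2 (Real.log_le_log h2.1 (max_le_max_right _ hts)))
    (hg.nonneg (Ioc_subset_Icc_self h1) (Ioc_subset_Icc_self h2))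

end MetricTensor

/-! ### The field ξ on the simplex, and increment factors for maps on it. -/

section Simplex

variable {n : ℕ}

theorem mem_Icc_of_mem_Prob {μ : Fin n → ℝ} (hμ : μ ∈ Prob n) (i : Fin n) :
    μ i ∈ Icc (0 : ℝ) 1 :=
  ⟨hμ.1 i, hμ.2 ▸ Finset.single_le_sum (fun j _ => hμ.1 j) (Finset.mem_univ i)⟩

/-- Summation by parts on a graph: for an edge function `w` that changes sign when the two vertices
are exchanged, twice the sum of `a i * w i j` is the sum of `w i j * (a i - a j)`. -/
theorem sum_edges_mul_of_swap (G : SimpleGraph (Fin n)) [DecidableRel G.Adj] (a : Fin n → ℝ)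
    {w : Fin n → Fin n → ℝ} (hw : ∀ i j, w j i = -w i j) :
    2 * ∑ i, a i * ∑ j with G.Adj i j, w i j =
      ∑ i, ∑ j with G.Adj i j, w i j * (a i - a j) := by
  have h1 : ∑ i, a i * ∑ j with G.Adj i j, w i j =
      ∑ i, ∑ j, if G.Adj i j then w i j * a i else 0 := by
    refine Finset.sum_congr rfl fun i _ => ?_
    rw [Finset.mul_sum, Finset.sum_filter]
    exact Finset.sum_congr rfl fun j _ => by split_ifs <;> ring
  have h2 : ∑ i, a i * ∑ j with G.Adj i j, w i j =
      ∑ i, ∑ j, if G.Adj i j then -(w i j * a j) else 0 := by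
    rw [h1, Finset.sum_comm]
    refine Finset.sum_congr rfl fun i _ => Finset.sum_congr rfl fun j _ => ?_
    simp only [G.adj_comm j i, hw i j, neg_mul]
  rw [two_mul]
  nth_rewrite 1 [h1]
  rw [h2, ← Finset.sum_add_distrib]
  refine Finset.sum_congr rfl fun i _ => ?_
  rw [← Finset.sum_add_distrib, Finset.sum_filter]
  exact Finset.sum_congr rfl fun j _ => by split_ifs <;> ring

/-- The total `∑ f i (ξ μ) i` is the extended noise operator applied to the graph gradient. -/
theorem noiseExt_grad (Γ : WeightedGraph n) {g : ℝ → ℝ → ℝ} (hg : IsMetricTensor g)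
    (hgBar : ContinuousOn (Function.uncurry (gBar g)) (Icc 0 1 ×ˢ Icc 0 1)) {μ : Fin n → ℝ}
    (hμ : μ ∈ Prob n) (f : Fin n → ℝ) :
    noiseExt Γ g μ (grad Γ f) = ∑ i, f i * xi Γ g μ i := by
  classical
  have h := sum_edges_mul_of_swap Γ.graph f (w := fun i j => Γ.weight i j * gBar g (μ j) (μ i))
    fun i j => by
      rw [Γ.weight_symm j i, gBar_swap hg hgBar (mem_Icc_of_mem_Prob hμ j)
        (mem_Icc_of_mem_Prob hμ i), mul_neg]
  have h' : noiseExt Γ g μ (grad Γ f) = (1 / 2) * ∑ i, ∑ j with Γ.graph.Adj i j,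
      Γ.weight i j * gBar g (μ j) (μ i) * (f i - f j) := by
    unfold noiseExt
    rw [← mul_neg, ← Finset.sum_neg_distrib]
    congr 1
    refine Finset.sum_congr rfl fun i _ => ?_
    rw [← Finset.sum_neg_distrib]
    refine Finset.sum_congr (by congr) fun j hj => ?_
    -- One √ω comes from the noise operator and one from the gradient.
    have hw := Real.mul_self_sqrt (Γ.weight_pos i j (Finset.mem_filter.1 hj).2).le
    simp only [grad, Matrix.of_apply]
    rw [gBar_swap hg hgBar (mem_Icc_of_mem_Prob hμ i) (mem_Icc_of_mem_Prob hμ j)]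
    nth_rewrite 3 [← hw]
    ring
  rw [h', ← h]
  unfold xi
  ring_nf

/-- Conservation of mass: the constant function 1 has zero graph gradient. -/
theorem sum_xi (Γ : WeightedGraph n) {g : ℝ → ℝ → ℝ} (hg : IsMetricTensor g)
    (hgBar : ContinuousOn (Function.uncurry (gBar g)) (Icc 0 1 ×ˢ Icc 0 1)) {μ : Fin n → ℝ}
    (hμ : μ ∈ Prob n) : ∑ i, xi Γ g μ i = 0 := by
  have h := noiseExt_grad Γ hg hgBar hμ 1
  simp only [Pi.one_apply, one_mul] at h
  rw [← h]
  simp [noiseExt, grad]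

/-- `ξ` points into the simplex at the points where an entry vanishes. -/
theorem xi_nonneg_of_eq_zero (Γ : WeightedGraph n) {g : ℝ → ℝ → ℝ} (hg : IsMetricTensor g)
    (hgBar : ContinuousOn (Function.uncurry (gBar g)) (Icc 0 1 ×ˢ Icc 0 1)) {μ : Fin n → ℝ}
    (hμ : μ ∈ Prob n) {i : Fin n} (hi : μ i = 0) : 0 ≤ xi Γ g μ i := by
  classical
  refine Finset.sum_nonneg fun j hj => mul_nonneg
    (Γ.weight_pos i j (Finset.mem_filter.1 hj).2).le ?_
  exact gBar_nonneg hg hgBar (mem_Icc_of_mem_Prob hμ j) (mem_Icc_of_mem_Prob hμ i)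
    (hi ▸ hμ.1 j)

/-- Moving all mass at i to another vertex j gives a point ν of the simplex with ν_i = 0, at sup
distance at most μ_i from μ. There ξ_i ≥ 0, and the Lipschitz bound loses at most K μ_i on the way
back. If i is the only vertex, ξ_i = 0. -/
theorem neg_mul_le_xi (Γ : WeightedGraph n) {g : ℝ → ℝ → ℝ} (hg : IsMetricTensor g)
    (hgBar : ContinuousOn (Function.uncurry (gBar g)) (Icc 0 1 ×ˢ Icc 0 1)) {K : NNReal}
    (hK : LipschitzOnWith K (xi Γ g) (Prob n)) {μ : Fin n → ℝ}
    (hμ : μ ∈ Prob n) (i : Fin n) : -(K * μ i) ≤ xi Γ g μ i := by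
  classical
  by_cases hj : ∃ j, j ≠ i
  · obtain ⟨j, hj⟩ := hj
    set ν : Fin n → ℝ := fun k => μ k + (if k = j then μ i else 0) - (if k = i then μ i else 0)
    have hνi : ν i = 0 := by simp [ν, hj.symm]
    have hν : ν ∈ Prob n := by
      refine ⟨fun k => ?_, ?_⟩
      · have h1 := hμ.1 k
        have h2 := hμ.1 i
        by_cases hk : k = i
        · rw [hk, hνi]
        · simp only [ν, if_neg hk, sub_zero]
          split_ifs <;> linarith
      · simp only [ν, Finset.sum_sub_distrib, Finset.sum_add_distrib, Finset.sum_ite_eq',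
          Finset.mem_univ, if_true]
        linarith [hμ.2]
    have hd : dist ν μ ≤ μ i := by
      refine (dist_pi_le_iff (hμ.1 i)).2 fun k => ?_
      have h2 := hμ.1 i
      rw [Real.dist_eq, abs_le]
      simp only [ν]
      split_ifs with h3 h4
      · exact absurd (h3.symm.trans h4) hj
      all_goals constructor <;> linarith
    have h1 : dist (xi Γ g ν i) (xi Γ g μ i) ≤ K * μ i :=
      (dist_le_pi_dist _ _ i).trans ((hK.dist_le_mul ν hν μ hμ).trans
        (mul_le_mul_of_nonneg_left hd K.2))
    rw [Real.dist_eq, abs_le] at h1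
    linarith [xi_nonneg_of_eq_zero Γ hg hgBar hν hνi, h1.2]
  · have : xi Γ g μ i = 0 := by
      unfold xi
      rw [Finset.filter_false_of_mem, Finset.sum_empty]
      intro j _ hadj
      exact hj ⟨j, hadj.ne'⟩
    rw [this]
    exact neg_nonpos.2 (mul_nonneg K.2 (hμ.1 i))

/-- A short Euler step along `ξ` stays in the simplex. -/
theorem add_smul_xi_mem (Γ : WeightedGraph n) {g : ℝ → ℝ → ℝ} (hg : IsMetricTensor g)
    (hgBar : ContinuousOn (Function.uncurry (gBar g)) (Icc 0 1 ×ˢ Icc 0 1)) {K : NNReal}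
    (hK : LipschitzOnWith K (xi Γ g) (Prob n)) {μ : Fin n → ℝ}
    (hμ : μ ∈ Prob n) : μ + (1 / (K + 1) : ℝ) • xi Γ g μ ∈ Prob n := by
  have hK0 : (0 : ℝ) ≤ K := K.2
  refine ⟨fun i => ?_, ?_⟩
  · have h1 := neg_mul_le_xi Γ hg hgBar hK hμ i
    have h2 := hμ.1 i
    -- The step 1/(K+1) makes μ_i + hξ_i equal to h times the sum of μ_i and the nonnegative K μ_i +
    -- ξ_i.
    have h3 : 0 ≤ (1 / (K + 1) : ℝ) * (μ i + (K * μ i + xi Γ g μ i)) :=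
      mul_nonneg (by positivity) (by linarith)
    have e : (1 / (K + 1) : ℝ) * (μ i + (K * μ i + xi Γ g μ i)) =
        μ i + (1 / (K + 1) : ℝ) * xi Γ g μ i := by field_simp; ring
    rw [e] at h3
    exact h3
  · simp only [Pi.add_apply, Pi.smul_apply, smul_eq_mul, Finset.sum_add_distrib,
      ← Finset.mul_sum, sum_xi Γ hg hgBar hμ, mul_zero, add_zero]
    exact hμ.2

/-- The linear map which sends the unit vector at `i` to `c i`. -/
noncomputable def ofColumns {V : Type*} [NormedAddCommGroup V] [NormedSpace ℝ V]
    (c : Fin n → V) : (Fin n → ℝ) →L[ℝ] V :=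
  ∑ i, ContinuousLinearMap.smulRightL ℝ (Fin n → ℝ) V (ContinuousLinearMap.proj i) (c i)

theorem ofColumns_apply {V : Type*} [NormedAddCommGroup V] [NormedSpace ℝ V]
    (c : Fin n → V) (x : Fin n → ℝ) : ofColumns c x = ∑ i, x i • c i := by
  simp [ofColumns]

theorem continuous_ofColumns {V : Type*} [NormedAddCommGroup V] [NormedSpace ℝ V] :
    Continuous (ofColumns : (Fin n → V) → (Fin n → ℝ) →L[ℝ] V) := by
  unfold ofColumns
  fun_prop

/-- A linear map on the differences of two points of the simplex is determined by its values on
the differences of the vertices to a base point. -/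
theorem ofColumns_single_sub {V : Type*} [NormedAddCommGroup V] [NormedSpace ℝ V]
    (L : (Fin n → ℝ) →L[ℝ] V) (x : Fin n → ℝ) {y z : Fin n → ℝ} (hy : y ∈ Prob n)
    (hz : z ∈ Prob n) :
    ofColumns (fun i => L (Pi.single i 1 - x)) (y - z) = L (y - z) := by
  have h0 : ∑ i, (y - z) i = 0 := by simp [hy.2, hz.2]
  have h1 : y - z = ∑ i, (y - z) i • (Pi.single i (1 : ℝ) : Fin n → ℝ) := by
    conv_lhs => rw [← Finset.univ_sum_single (y - z)]
    refine Finset.sum_congr rfl fun i _ => ?_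
    rw [← Pi.single_smul, smul_eq_mul, mul_one]
  rw [ofColumns_apply]
  simp only [map_sub, smul_sub, Finset.sum_sub_distrib]
  rw [← Finset.sum_smul, h0, zero_smul, sub_zero, ← map_sub]
  conv_rhs => rw [h1, map_sum]
  simp

theorem single_mem_Prob (i : Fin n) : (Pi.single i 1 : Fin n → ℝ) ∈ Prob n :=
  single_mem_stdSimplex ℝ i

/-- A `C¹` map on the simplex has a continuous increment factor. -/
theorem exists_increment_factor_of_contDiffOn {f : (Fin n → ℝ) → Fin n → ℝ}
    (hf : ContDiffOn ℝ 1 f (Prob n)) :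
    ∃ G : (Fin n → ℝ) × (Fin n → ℝ) → (Fin n → ℝ) →L[ℝ] (Fin n → ℝ), ∃ C : ℝ,
      Continuous G ∧ (∀ p, ‖G p‖ ≤ C) ∧
      ∀ a ∈ Prob n, ∀ b ∈ Prob n, f b - f a = G (a, b) (b - a) := by
  have hconv : Convex ℝ (Prob n) := convex_stdSimplex ℝ (Fin n)
  have hline : ∀ x ∈ Prob n, ∀ y ∈ Prob n, ∀ L : (Fin n → ℝ) →L[ℝ] (Fin n → ℝ),
      HasFDerivWithinAt f L (Prob n) x →
      HasDerivWithinAt (fun t : ℝ => f (x + t • (y - x))) (L (y - x)) (Icc 0 1) 0 := by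
    intro x hx y hy L hL
    have h1 : HasDerivWithinAt (fun t : ℝ => x + t • (y - x)) (y - x) (Icc 0 1) 0 := by
      simpa using (((hasDerivAt_id (0 : ℝ)).smul_const (y - x)).const_add x).hasDerivWithinAt
    have e : x = x + (0 : ℝ) • (y - x) := by simp
    exact HasFDerivWithinAt.comp_hasDerivWithinAt_of_eq (0 : ℝ) hL h1
      (fun t ht => hconv.add_smul_sub_mem hx hy ht) e
  have huniq : ∀ x ∈ Prob n, ∀ y ∈ Prob n, ∀ L : (Fin n → ℝ) →L[ℝ] (Fin n → ℝ),
      HasFDerivWithinAt f L (Prob n) x → fderivWithin ℝ f (Prob n) x (y - x) = L (y - x) := by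
    intro x hx y hy L hL
    exact ((uniqueDiffOn_Icc one_pos) 0 ⟨le_rfl, zero_le_one⟩).eq_deriv _
      (hline x hx y hy _ hL.differentiableWithinAt.hasFDerivWithinAt) (hline x hx y hy L hL)
  -- The simplex determines a derivative only on differences of its points, so `fderivWithin` may
  -- vary discontinuously in transversal directions. `D` is rebuilt from the determined values
  -- alone.
  set D : (Fin n → ℝ) → (Fin n → ℝ) →L[ℝ] (Fin n → ℝ) := fun x =>
    ofColumns fun i => fderivWithin ℝ f (Prob n) x (Pi.single i 1 - x)
  have hD : ContinuousOn D (Prob n) := by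
    refine continuous_ofColumns.comp_continuousOn (continuousOn_pi.2 fun i x hx => ?_)
    -- The C¹ condition provides, near x, derivatives `f'` that are continuous at x; `huniq`
    -- identifies their values on e_i - y with those of `fderivWithin`.
    have h := hf x hx
    rw [show (1 : WithTop ℕ∞) = 0 + 1 by simp,
      contDiffWithinAt_succ_iff_hasFDerivWithinAt' (by simp)] at h
    obtain ⟨u, hu, hus, -, f', hf', hc⟩ := h
    rw [insert_eq_of_mem hx] at hu hus
    have h1 : ContinuousWithinAt (fun y => f' y (Pi.single i 1 - y)) (Prob n) x :=
      hc.continuousWithinAt.clm_apply (by fun_prop)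
    refine h1.congr_of_eventuallyEq ?_ ?_
    · filter_upwards [hu] with y hy
      exact huniq y (hus hy) _ (single_mem_Prob i) _ (hf' y hy)
    · exact huniq x hx _ (single_mem_Prob i) _ (hf' x (mem_of_mem_nhdsWithin hx hu))
  obtain ⟨D', C, hD', hC, hDD⟩ := exists_bounded_continuous_extension
    (isCompact_stdSimplex ℝ (Fin n)) hD
  obtain ⟨G, hG, hGC, -, hGf⟩ := exists_continuous_increment_factor hconv hD' hC (f := f) <| by
    intro x hx y hy
    rw [hDD hx]
    have hd := (hf.differentiableOn (by simp) x hx).hasFDerivWithinAt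
    have := hline x hx y hy _ hd
    rwa [← ofColumns_single_sub _ x hy hx] at this
  exact ⟨G, C, hG, hGC, hGf⟩

/-- A Fréchet continuously differentiable function on the simplex has a continuous increment
factor. -/
theorem GraphHJ.FrechetC1.exists_increment_factor {f : (Fin n → ℝ) → ℝ} (hf : FrechetC1 f) :
    ∃ G : (Fin n → ℝ) × (Fin n → ℝ) → (Fin n → ℝ) →L[ℝ] ℝ, Continuous G ∧
      ∀ a ∈ Prob n, ∀ b ∈ Prob n, f b - f a = G (a, b) (b - a) := by
  obtain ⟨d, hd, hdf⟩ := hf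
  have hconv : Convex ℝ (Prob n) := convex_stdSimplex ℝ (Fin n)
  obtain ⟨D', C, hD', hC, hDD⟩ := exists_bounded_continuous_extension
    (isCompact_stdSimplex ℝ (Fin n)) (continuous_ofColumns.comp_continuousOn hd)
  obtain ⟨G, hG, -, -, hGf⟩ := exists_continuous_increment_factor hconv hD' hC (f := f) <| by
    intro x hx y hy
    rw [hDD hx]
    have h := (hdf x hx).2 y hy
    have e : (ofColumns ∘ d) x (y - x) = ∑ i, d x i * (y i - x i) := by
      simp [ofColumns_apply, mul_comm]
    rw [e, hasDerivWithinAt_iff_tendsto_slope]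
    have hset : 𝓝[Icc (0 : ℝ) 1 \ {0}] 0 = 𝓝[>] 0 := by
      rw [Icc_sdiff_left, nhdsWithin_Ioc_eq_nhdsGT one_pos]
    rw [hset]
    refine h.congr fun t => ?_
    rw [slope_def_field, sub_zero, zero_smul, add_zero]
    congr 3
    rw [smul_sub, sub_smul, one_smul]
    abel
  exact ⟨G, hG, hGf⟩

end Simplex

/-! ### The Wasserstein distance and Wasserstein gradients. -/

section Wasserstein

variable {n : ℕ} {Γ : WeightedGraph n} {g : ℝ → ℝ → ℝ}

theorem GraphHJ.IsSkew.apply {v : Matrix (Fin n) (Fin n) ℝ} (hv : IsSkew v) (i j : Fin n) :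
    v j i = -v i j :=
  congrFun (congrFun hv i) j

theorem isSkew_grad (Γ : WeightedGraph n) (φ : Fin n → ℝ) : IsSkew (grad Γ φ) := by
  ext i j
  simp only [grad, Matrix.transpose_apply, Matrix.neg_apply, Matrix.of_apply, Γ.weight_symm j i]
  ring

theorem isTangent_grad (Γ : WeightedGraph n) (g : ℝ → ℝ → ℝ) (ρ φ : Fin n → ℝ) :
    IsTangent Γ g ρ (grad Γ φ) :=
  ⟨isSkew_grad Γ φ, fun _ => φ, by simp [gNorm, gInner]⟩

theorem grad_smul (Γ : WeightedGraph n) (c : ℝ) (φ : Fin n → ℝ) :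
    grad Γ (c • φ) = c • grad Γ φ := by
  ext i j
  simp only [grad, Matrix.of_apply, Matrix.smul_apply, Pi.smul_apply, smul_eq_mul]
  ring

theorem graphDiv_smul (Γ : WeightedGraph n) (g : ℝ → ℝ → ℝ) (ρ : Fin n → ℝ) (c : ℝ)
    (v : Matrix (Fin n) (Fin n) ℝ) : GraphHJ.div Γ g ρ (c • v) = c • GraphHJ.div Γ g ρ v := by
  funext i
  simp only [GraphHJ.div, Pi.smul_apply, Matrix.smul_apply, smul_eq_mul, Finset.mul_sum]
  exact Finset.sum_congr rfl fun j _ => by ring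

theorem gInner_smul_right (Γ : WeightedGraph n) (g : ℝ → ℝ → ℝ) (ρ : Fin n → ℝ) (c : ℝ)
    (v w : Matrix (Fin n) (Fin n) ℝ) : gInner Γ g ρ v (c • w) = c * gInner Γ g ρ v w := by
  simp only [gInner, Matrix.smul_apply, smul_eq_mul, Finset.mul_sum]
  exact Finset.sum_congr rfl fun i _ => Finset.sum_congr rfl fun j _ => by ring

theorem gInner_comm (Γ : WeightedGraph n) (g : ℝ → ℝ → ℝ) (ρ : Fin n → ℝ)
    (v w : Matrix (Fin n) (Fin n) ℝ) : gInner Γ g ρ v w = gInner Γ g ρ w v := by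
  simp only [gInner]
  congr 1
  exact Finset.sum_congr rfl fun i _ => Finset.sum_congr rfl fun j _ => by ring

/-- The divergence is the negative adjoint of the gradient. -/
theorem gInner_grad (hg : IsMetricTensor g) {ρ : Fin n → ℝ} (hρ : ρ ∈ Prob n) (φ : Fin n → ℝ)
    {v : Matrix (Fin n) (Fin n) ℝ} (hv : IsSkew v) :
    gInner Γ g ρ (grad Γ φ) v = -∑ i, φ i * GraphHJ.div Γ g ρ v i := by
  classical
  have h := sum_edges_mul_of_swap Γ.graph φ
    (w := fun i j => √(Γ.weight i j) * g (ρ i) (ρ j) * v j i) fun i j => by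
      rw [Γ.weight_symm j i, hg.symm _ (mem_Icc_of_mem_Prob hρ j) _ (mem_Icc_of_mem_Prob hρ i),
        hv.apply j i, mul_neg]
  have h1 : gInner Γ g ρ (grad Γ φ) v = -((1 / 2) * ∑ i, ∑ j with Γ.graph.Adj i j,
      √(Γ.weight i j) * g (ρ i) (ρ j) * v j i * (φ i - φ j)) := by
    unfold gInner
    rw [← mul_neg, ← Finset.sum_neg_distrib]
    congr 1
    refine Finset.sum_congr rfl fun i _ => ?_
    rw [← Finset.sum_neg_distrib]
    refine Finset.sum_congr (by congr) fun j hj => ?_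
    simp only [grad, Matrix.of_apply, hv.apply i j]
    ring
  rw [h1, ← h]
  unfold GraphHJ.div
  ring_nf

theorem sum_div (hg : IsMetricTensor g) {ρ : Fin n → ℝ} (hρ : ρ ∈ Prob n)
    {v : Matrix (Fin n) (Fin n) ℝ} (hv : IsSkew v) : ∑ i, GraphHJ.div Γ g ρ v i = 0 := by
  have h := gInner_grad (Γ := Γ) hg hρ 1 hv
  simp only [Pi.one_apply, one_mul] at h
  rw [← neg_eq_zero, ← h]
  simp [gInner, grad]

theorem gInner_self_nonneg (hg : IsMetricTensor g) {ρ : Fin n → ℝ} (hρ : ρ ∈ Prob n)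
    (v : Matrix (Fin n) (Fin n) ℝ) : 0 ≤ gInner Γ g ρ v v := by
  refine mul_nonneg (by norm_num) (Finset.sum_nonneg fun i _ => Finset.sum_nonneg fun j _ => ?_)
  rw [mul_assoc]
  exact mul_nonneg (hg.nonneg (mem_Icc_of_mem_Prob hρ i) (mem_Icc_of_mem_Prob hρ j))
    (mul_self_nonneg _)

/-- Since g ≤ 1, each flux satisfies (g v_ij)² ≤ g v_ij² ≤ 2 (v,v)_ρ, so |g v_ij| ≤ 2‖v‖_ρ, and this
2 cancels the ½ of the inner product. The resulting constant does not depend on ρ. -/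
theorem abs_gInner_le (hg : IsMetricTensor g) {ρ : Fin n → ℝ} (hρ : ρ ∈ Prob n)
    (a v : Matrix (Fin n) (Fin n) ℝ) :
    |gInner Γ g ρ a v| ≤ (∑ i, ∑ j, |a i j|) * gNorm Γ g ρ v := by
  classical
  have hpos : ∀ i j, 0 ≤ g (ρ i) (ρ j) := fun i j =>
    hg.nonneg (mem_Icc_of_mem_Prob hρ i) (mem_Icc_of_mem_Prob hρ j)
  have hterm : ∀ i j, 0 ≤ g (ρ i) (ρ j) * v i j * v i j := fun i j => by
    rw [mul_assoc]; exact mul_nonneg (hpos i j) (mul_self_nonneg _)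
  have h1 : ∀ i j, Γ.graph.Adj i j → |g (ρ i) (ρ j) * v i j| ≤ 2 * gNorm Γ g ρ v := by
    intro i j hij
    refine abs_le_of_sq_le_sq ?_ (mul_nonneg two_pos.le (Real.sqrt_nonneg _))
    rw [gNorm, mul_pow 2, Real.sq_sqrt (gInner_self_nonneg hg hρ v)]
    have h2 : g (ρ i) (ρ j) * v i j * v i j ≤ ∑ j with Γ.graph.Adj i j,
        g (ρ i) (ρ j) * v i j * v i j :=
      Finset.single_le_sum (f := fun j => g (ρ i) (ρ j) * v i j * v i j)
        (fun j _ => hterm i j) (Finset.mem_filter.2 ⟨Finset.mem_univ j, hij⟩)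
    have h3 : ∑ j with Γ.graph.Adj i j, g (ρ i) (ρ j) * v i j * v i j ≤
        ∑ i, ∑ j with Γ.graph.Adj i j, g (ρ i) (ρ j) * v i j * v i j :=
      Finset.single_le_sum (f := fun i => ∑ j with Γ.graph.Adj i j,
        g (ρ i) (ρ j) * v i j * v i j)
        (fun i _ => Finset.sum_nonneg fun j _ => hterm i j) (Finset.mem_univ i)
    have h4 : gInner Γ g ρ v v = (1 / 2) * ∑ i, ∑ j with Γ.graph.Adj i j,
        g (ρ i) (ρ j) * v i j * v i j := by
      unfold gInner; congr!
    have h5 : (g (ρ i) (ρ j) * v i j) ^ 2 ≤ g (ρ i) (ρ j) * v i j * v i j := by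
      have := mul_le_mul_of_nonneg_right
        (hg.le_one (mem_Icc_of_mem_Prob hρ i) (mem_Icc_of_mem_Prob hρ j)) (hterm i j)
      nlinarith
    have h6 := hterm i j
    linarith
  have hN : 0 ≤ gNorm Γ g ρ v := Real.sqrt_nonneg _
  unfold gInner
  rw [abs_mul, abs_of_pos (by norm_num : (0 : ℝ) < 1 / 2), Finset.sum_mul]
  refine (mul_le_mul_of_nonneg_left (Finset.abs_sum_le_sum_abs _ _) (by norm_num)).trans ?_
  rw [Finset.mul_sum]
  refine Finset.sum_le_sum fun i _ => ?_
  rw [Finset.sum_mul, one_div, inv_mul_le_iff₀ two_pos, Finset.mul_sum]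
  refine (Finset.abs_sum_le_sum_abs _ _).trans ?_
  refine (Finset.sum_le_sum fun j hj => ?_).trans (Finset.sum_le_sum_of_subset_of_nonneg
    (f := fun j => 2 * (|a i j| * gNorm Γ g ρ v)) (Finset.filter_subset _ _)
    fun j _ _ => by positivity)
  rw [show g (ρ i) (ρ j) * a i j * v i j = a i j * (g (ρ i) (ρ j) * v i j) by ring, abs_mul]
  have := mul_le_mul_of_nonneg_left (h1 i j (Finset.mem_filter.1 hj).2) (abs_nonneg (a i j))
  linarith

theorem aemeasurable_gNorm (hg : IsMetricTensor g) {ρ₀ ρ₁ : Fin n → ℝ} {σ : ℝ → Fin n → ℝ}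
    {v : ℝ → Matrix (Fin n) (Fin n) ℝ} (h : IsAdmissible Γ g ρ₀ ρ₁ σ v) :
    AEMeasurable (fun t => gNorm Γ g (σ t) (v t)) (volume.restrict (Icc 0 1)) := by
  have h1 : ∀ i j, AEMeasurable (fun t => g (σ t i) (σ t j)) (volume.restrict (Icc 0 1)) := by
    intro i j
    have hc : ContinuousOn (fun t => g (σ t i) (σ t j)) (Icc 0 1) :=
      hg.continuousOn.comp (f := fun t => (σ t i, σ t j))
        ((continuousOn_pi.1 h.continuousOn i).prodMk (continuousOn_pi.1 h.continuousOn j))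
        fun t ht => ⟨mem_Icc_of_mem_Prob (h.mem t ht) i, mem_Icc_of_mem_Prob (h.mem t ht) j⟩
    exact hc.aemeasurable measurableSet_Icc
  refine Real.continuous_sqrt.measurable.comp_aemeasurable ?_
  refine AEMeasurable.const_mul ?_ _
  refine Finset.aemeasurable_fun_sum _ fun i _ => Finset.aemeasurable_fun_sum _ fun j _ => ?_
  exact ((h1 i j).mul (h.measurable i j).aemeasurable).mul (h.measurable i j).aemeasurable

/-- Test the continuity equation with φ constant in time, bound the integrand by `abs_gInner_le`,
and apply Cauchy–Schwarz in time against the constant 1. -/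
theorem ofReal_abs_le_of_isAdmissible (hg : IsMetricTensor g) {ρ₀ ρ₁ : Fin n → ℝ}
    {σ : ℝ → Fin n → ℝ} {v : ℝ → Matrix (Fin n) (Fin n) ℝ}
    (h : IsAdmissible Γ g ρ₀ ρ₁ σ v) (φ : Fin n → ℝ) :
    ENNReal.ofReal |∑ i, φ i * (ρ₁ i - ρ₀ i)| ≤
      ENNReal.ofReal (∑ i, ∑ j, |grad Γ φ i j|) *
        (∫⁻ t in Icc (0 : ℝ) 1, ENNReal.ofReal (gNorm Γ g (σ t) (v t) ^ 2)) ^ (1 / 2 : ℝ) := by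
  have hA : 0 ≤ ∑ i, ∑ j, |grad Γ φ i j| :=
    Finset.sum_nonneg fun i _ => Finset.sum_nonneg fun j _ => abs_nonneg _
  have h0 := h.continuity (fun _ => φ) contDiff_const
  simp only [deriv_const, Pi.zero_apply, zero_mul, Finset.sum_const_zero, zero_add, h.start,
    h.finish] at h0
  have h1 : ∑ i, φ i * (ρ₁ i - ρ₀ i) =
      ∫ t in Icc (0 : ℝ) 1, gInner Γ g (σ t) (grad Γ φ) (v t) := by
    rw [integral_Icc_eq_integral_Ioc, ← intervalIntegral.integral_of_le zero_le_one,
      ← sub_eq_zero.1 h0, ← Finset.sum_sub_distrib]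
    exact Finset.sum_congr rfl fun i _ => by ring
  have hcs : ∫⁻ t in Icc (0 : ℝ) 1, ENNReal.ofReal (gNorm Γ g (σ t) (v t)) ≤
      (∫⁻ t in Icc (0 : ℝ) 1, ENNReal.ofReal (gNorm Γ g (σ t) (v t) ^ 2)) ^ (1 / 2 : ℝ) := by
    have := ENNReal.lintegral_mul_le_Lp_mul_Lq (volume.restrict (Icc (0 : ℝ) 1))
      Real.HolderConjugate.two_two (aemeasurable_gNorm hg h).ennreal_ofReal
      (g := fun _ => 1) aemeasurable_const
    simp only [Pi.mul_apply, mul_one, ENNReal.one_rpow, lintegral_const,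
      Measure.restrict_apply_univ, Real.volume_Icc, sub_zero, ENNReal.ofReal_one] at this
    refine this.trans_eq ?_
    congr 2
    funext t
    rw [ENNReal.rpow_two]
    exact (ENNReal.ofReal_pow (Real.sqrt_nonneg _) 2).symm
  calc ENNReal.ofReal |∑ i, φ i * (ρ₁ i - ρ₀ i)|
      = ‖∫ t in Icc (0 : ℝ) 1, gInner Γ g (σ t) (grad Γ φ) (v t)‖ₑ := by
        rw [h1, Real.enorm_eq_ofReal_abs]
    _ ≤ ∫⁻ t in Icc (0 : ℝ) 1, ‖gInner Γ g (σ t) (grad Γ φ) (v t)‖ₑ :=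
        enorm_integral_le_lintegral_enorm _
    _ ≤ ∫⁻ t in Icc (0 : ℝ) 1, ENNReal.ofReal (∑ i, ∑ j, |grad Γ φ i j|) *
          ENNReal.ofReal (gNorm Γ g (σ t) (v t)) := by
        refine setLIntegral_mono' measurableSet_Icc fun t ht => ?_
        rw [Real.enorm_eq_ofReal_abs, ← ENNReal.ofReal_mul hA]
        exact ENNReal.ofReal_le_ofReal (abs_gInner_le hg (h.mem t ht) _ _)
    _ ≤ _ := by
        rw [lintegral_const_mul' _ _ ENNReal.ofReal_ne_top]
        gcongr

/-- The Wasserstein distance controls the pairing of the difference with a fixed vector. -/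
theorem ofReal_abs_le_wasserstein (hg : IsMetricTensor g) (ρ₀ ρ₁ φ : Fin n → ℝ) :
    ENNReal.ofReal |∑ i, φ i * (ρ₁ i - ρ₀ i)| ≤
      ENNReal.ofReal (∑ i, ∑ j, |grad Γ φ i j| + 1) * wasserstein Γ g ρ₀ ρ₁ := by
  set A := ∑ i, ∑ j, |grad Γ φ i j|
  have hA : 0 ≤ A := Finset.sum_nonneg fun i _ => Finset.sum_nonneg fun j _ => abs_nonneg _
  -- `A` may vanish; a nonzero constant can be divided out, which leaves a lower bound for the
  -- infimum alone.
  have hA1 : 0 < A + 1 := by linarith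
  have hne : ENNReal.ofReal (A + 1) ≠ 0 := (ENNReal.ofReal_pos.2 hA1).ne'
  rw [mul_comm, ← ENNReal.div_le_iff hne ENNReal.ofReal_ne_top, wasserstein, one_div,
    ENNReal.le_rpow_inv_iff two_pos]
  refine le_iInf fun σ => le_iInf fun v => le_iInf fun h => ?_
  rw [← ENNReal.le_rpow_inv_iff two_pos, ENNReal.div_le_iff hne ENNReal.ofReal_ne_top, mul_comm,
    ← one_div]
  refine (ofReal_abs_le_of_isAdmissible hg h φ).trans ?_
  gcongr
  linarith

/-- The Wasserstein distance dominates the `ℓ¹` distance, up to a constant. -/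
theorem exists_ofReal_l1Norm_le_wasserstein (Γ : WeightedGraph n) (hg : IsMetricTensor g) :
    ∃ A : ℝ, 0 < A ∧ ∀ ρ₀ ρ₁ : Fin n → ℝ,
      ENNReal.ofReal (l1Norm (ρ₁ - ρ₀)) ≤ ENNReal.ofReal A * wasserstein Γ g ρ₀ ρ₁ := by
  have hB : ∀ k : Fin n, (0 : ℝ) ≤ ∑ i, ∑ j, |grad Γ (Pi.single k 1) i j| + 1 := fun k =>
    add_nonneg (Finset.sum_nonneg fun _ _ => Finset.sum_nonneg fun _ _ => abs_nonneg _) zero_le_one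
  refine ⟨∑ k : Fin n, (∑ i, ∑ j, |grad Γ (Pi.single k 1) i j| + 1) + 1,
    add_pos_of_nonneg_of_pos (Finset.sum_nonneg fun k _ => hB k) one_pos, fun ρ₀ ρ₁ => ?_⟩
  have h : ∀ k : Fin n, ENNReal.ofReal |(ρ₁ - ρ₀) k| ≤
      ENNReal.ofReal (∑ i, ∑ j, |grad Γ (Pi.single k 1) i j| + 1) * wasserstein Γ g ρ₀ ρ₁ := by
    intro k
    have := ofReal_abs_le_wasserstein (Γ := Γ) hg ρ₀ ρ₁ (Pi.single k 1)
    simpa [Pi.single_apply] using this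
  unfold l1Norm
  rw [ENNReal.ofReal_sum_of_nonneg fun k _ => abs_nonneg _]
  refine (Finset.sum_le_sum fun k _ => h k).trans ?_
  rw [← Finset.sum_mul, ← ENNReal.ofReal_sum_of_nonneg fun k _ => hB k]
  gcongr
  linarith

theorem norm_le_l1Norm (x : Fin n → ℝ) : ‖x‖ ≤ l1Norm x :=
  (pi_norm_le_iff_of_nonneg (Finset.sum_nonneg fun _ _ => abs_nonneg _)).2 fun i =>
    Finset.single_le_sum (f := fun i => |x i|) (fun _ _ => abs_nonneg _) (Finset.mem_univ i)

theorem clm_apply_eq_sum (L : (Fin n → ℝ) →L[ℝ] ℝ) (x : Fin n → ℝ) :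
    L x = ∑ i, L (Pi.single i 1) * x i := by
  conv_lhs => rw [← Finset.univ_sum_single x, map_sum]
  refine Finset.sum_congr rfl fun i _ => ?_
  rw [← mul_one (x i), ← smul_eq_mul (x i), Pi.single_smul, map_smul, smul_eq_mul, smul_eq_mul]
  ring

/-- If the increment of `F` at `ρ` is a factor continuous at `ρ` applied to the increment of the
variable, then the graph gradient of this factor is a Wasserstein gradient. -/
theorem isWassersteinGradient_grad (hg : IsMetricTensor g) {F : (Fin n → ℝ) → ℝ} {ρ : Fin n → ℝ}
    (hρ : ρ ∈ Prob n) {L : (Fin n → ℝ) → (Fin n → ℝ) →L[ℝ] ℝ}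
    (hL : ContinuousWithinAt L (Prob n) ρ)
    (hF : ∀ ρ' ∈ Prob n, F ρ' - F ρ = L ρ' (ρ' - ρ)) :
    IsWassersteinGradient Γ g F ρ (grad Γ fun i => L ρ (Pi.single i 1)) := by
  obtain ⟨A, hA, hAW⟩ := exists_ofReal_l1Norm_le_wasserstein Γ hg
  refine ⟨isTangent_grad _ _ _ _, ‖L ρ‖ + 1, by positivity, fun ε hε => ?_⟩
  obtain ⟨δ, hδ, hLδ⟩ := Metric.continuousWithinAt_iff.1 hL (ε / A) (div_pos hε hA)
  refine ⟨δ, hδ, fun ρ' hρ' v' hv' hd => ?_⟩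
  have hl1 : ∀ x : Fin n → ℝ, 0 ≤ l1Norm x := fun x => (norm_nonneg _).trans (norm_le_l1Norm x)
  -- By adjointness the error splits into the change of `L` on the increment, small relative to 𝒲,
  -- and `L ρ` on the residual ρ' - ρ + div v', absorbed by the constant c.
  have e : F ρ' - F ρ - gInner Γ g ρ (grad Γ fun i => L ρ (Pi.single i 1)) v' =
      (L ρ' - L ρ) (ρ' - ρ) + L ρ (ρ' - ρ + GraphHJ.div Γ g ρ v') := by
    rw [hF ρ' hρ', gInner_grad hg hρ _ hv'.1, ← clm_apply_eq_sum, _root_.sub_apply,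
      map_add]
    ring
  have hdist : dist (L ρ') (L ρ) < ε / A := hLδ hρ' (by
    rw [dist_eq_norm]; exact (norm_le_l1Norm _).trans_lt hd)
  rw [dist_eq_norm] at hdist
  have h1 : |(L ρ' - L ρ) (ρ' - ρ)| ≤ ε / A * l1Norm (ρ' - ρ) :=
    ((L ρ' - L ρ).le_opNorm _).trans
      (mul_le_mul hdist.le (norm_le_l1Norm _) (norm_nonneg _) (div_pos hε hA).le)
  have h2 : |L ρ (ρ' - ρ + GraphHJ.div Γ g ρ v')| ≤
      (‖L ρ‖ + 1) * l1Norm (ρ' - ρ + GraphHJ.div Γ g ρ v') :=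
    ((L ρ).le_opNorm _).trans
      (mul_le_mul (by linarith) (norm_le_l1Norm _) (norm_nonneg _) (by positivity))
  rw [e]
  calc ENNReal.ofReal |_| ≤ ENNReal.ofReal (ε / A * l1Norm (ρ' - ρ) +
        (‖L ρ‖ + 1) * l1Norm (ρ' - ρ + GraphHJ.div Γ g ρ v')) :=
        ENNReal.ofReal_le_ofReal ((abs_add_le _ _).trans (add_le_add h1 h2))
    _ = ENNReal.ofReal (ε / A) * ENNReal.ofReal (l1Norm (ρ' - ρ)) +
        ENNReal.ofReal ((‖L ρ‖ + 1) * l1Norm (ρ' - ρ + GraphHJ.div Γ g ρ v')) := by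
        rw [ENNReal.ofReal_add (mul_nonneg (div_pos hε hA).le (hl1 _))
          (mul_nonneg (by positivity) (hl1 _)), ENNReal.ofReal_mul (div_pos hε hA).le]
    _ ≤ ENNReal.ofReal (ε / A) * (ENNReal.ofReal A * wasserstein Γ g ρ ρ') + _ := by
        gcongr
        exact hAW ρ ρ'
    _ = _ := by
        rw [← mul_assoc, ← ENNReal.ofReal_mul (div_pos hε hA).le, div_mul_cancel₀ _ hA.ne']

/-- At a positive vector, moving along the flux of a graph gradient costs a Wasserstein distance
which is at most linear in the step. -/
theorem exists_wasserstein_le (hg : IsMetricTensor g) {μ : Fin n → ℝ} (hμ : μ ∈ PosProb n)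
    (φ : Fin n → ℝ) :
    ∃ C : ℝ, 0 ≤ C ∧ ∃ s₀ : ℝ, 0 < s₀ ∧ ∀ s ∈ Ioo 0 s₀,
      μ - s • GraphHJ.div Γ g μ (grad Γ φ) ∈ Prob n ∧
      wasserstein Γ g μ (μ - s • GraphHJ.div Γ g μ (grad Γ φ)) ≤ ENNReal.ofReal (C * s) := by
  classical
  have : Nonempty (Fin n) := Γ.connected.nonempty
  obtain ⟨hμP, hμpos⟩ := hμ
  set d := GraphHJ.div Γ g μ (grad Γ φ) with hd
  have hd0 : ∑ i, d i = 0 := sum_div hg hμP (isSkew_grad Γ φ)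
  obtain ⟨i₀, hi₀⟩ := Finite.exists_min μ
  set m := μ i₀
  have hm : 0 < m := hμpos i₀
  have hs₀ : 0 < m / 2 / (‖d‖ + 1) := by positivity
  -- Along the segment used below all entries stay above m/2, hence so does g; with g(μ_i, μ_j) ≤ 1
  -- this bounds the speed by c s.
  set c : ℝ := √((1 / 2) * ∑ i, ∑ j, (grad Γ φ i j) ^ 2 / (m / 2)) with hc
  refine ⟨c, Real.sqrt_nonneg _, _, hs₀,
    fun s hs => ?_⟩
  have hsd : ∀ r ∈ Icc (0 : ℝ) 1, ∀ i, m / 2 ≤ μ i - r * (s * d i) := by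
    intro r hr i
    have h1 : s * (‖d‖ + 1) < m / 2 := (lt_div_iff₀ (by positivity)).1 hs.2
    have h2 : s * d i ≤ s * (‖d‖ + 1) := mul_le_mul_of_nonneg_left
      ((le_abs_self _).trans ((norm_le_pi_norm d i).trans (by linarith))) hs.1.le
    have h3 : r * (s * d i) ≤ m / 2 := by
      have h4 : 0 ≤ s * (‖d‖ + 1) := mul_nonneg hs.1.le (by positivity)
      calc r * (s * d i) ≤ r * (s * (‖d‖ + 1)) := mul_le_mul_of_nonneg_left h2 hr.1
        _ ≤ 1 * (s * (‖d‖ + 1)) := mul_le_mul_of_nonneg_right hr.2 h4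
        _ ≤ m / 2 := by linarith
    linarith [hi₀ i]
  set τ : ℝ → Fin n → ℝ := fun t i => μ i - t * (s * d i) with hτ
  have hτP : ∀ r ∈ Icc (0 : ℝ) 1, τ r ∈ Prob n := by
    intro r hr
    refine ⟨fun i => (half_pos hm).le.trans (hsd r hr i), ?_⟩
    simp only [hτ, Finset.sum_sub_distrib, ← Finset.mul_sum, hd0, mul_zero, sub_zero]
    exact hμP.2
  have hτ1 : μ - s • d = τ 1 := by
    funext i; simp [hτ]
  have hτ0 : μ = τ 0 := by
    funext i; simp [hτ]
  -- Time is clamped to [0,1] because measurability and skewness of `v` are required at all real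
  -- times.
  set κ : ℝ → ℝ := fun t => projIcc (0 : ℝ) 1 zero_le_one t with hκ
  have hκmem : ∀ t, κ t ∈ Icc (0 : ℝ) 1 := fun t => (projIcc (0 : ℝ) 1 zero_le_one t).2
  have hκeq : ∀ t ∈ Icc (0 : ℝ) 1, κ t = t := fun t ht => by
    simp only [hκ, projIcc_of_mem _ ht]
  have hκc : Continuous κ := continuous_subtype_val.comp continuous_projIcc
  have hτc : Continuous τ := by
    simp only [hτ]; fun_prop
  have hIcc : ∀ t i, τ (κ t) i ∈ Icc (0 : ℝ) 1 := fun t i =>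
    mem_Icc_of_mem_Prob (hτP _ (hκmem t)) i
  have hgc : ∀ i j, Continuous fun t => g (τ (κ t) i) (τ (κ t) j) := by
    intro i j
    have hc : Continuous fun t => τ (κ t) := hτc.comp hκc
    exact hg.continuousOn.comp_continuous (f := fun t => (τ (κ t) i, τ (κ t) j))
      (by fun_prop) fun t => ⟨hIcc t i, hIcc t j⟩
  have hglb : ∀ t i j, m / 2 ≤ g (τ (κ t) i) (τ (κ t) j) := fun t i j =>
    (le_min (hsd _ (hκmem t) i) (hsd _ (hκmem t) j)).trans
      (hg.min_le _ (hIcc t i) _ (hIcc t j))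
  have hgpos : ∀ t i j, 0 < g (τ (κ t) i) (τ (κ t) j) := fun t i j =>
    (half_pos hm).trans_le (hglb t i j)
  -- Dividing by g along the curve keeps the flux g v constant, so the straight segment with
  -- velocity -s d solves the continuity equation.
  set v : ℝ → Matrix (Fin n) (Fin n) ℝ := fun t => Matrix.of fun i j =>
    s * g (μ i) (μ j) * grad Γ φ i j / g (τ (κ t) i) (τ (κ t) j) with hv
  have hgv : ∀ t i j, g (τ (κ t) i) (τ (κ t) j) * v t i j = s * g (μ i) (μ j) * grad Γ φ i j :=
    fun t i j => by simp only [hv, Matrix.of_apply]; exact mul_div_cancel₀ _ (hgpos t i j).ne'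
  have hvc : ∀ i j, Continuous fun t => v t i j := fun i j =>
    continuous_const.div (hgc i j) fun t => (hgpos t i j).ne'
  have hinner : ∀ t ψ, gInner Γ g (τ (κ t)) (grad Γ ψ) (v t) = -∑ i, ψ i * (s * d i) := by
    intro t ψ
    have h1 : gInner Γ g (τ (κ t)) (grad Γ ψ) (v t) = gInner Γ g μ (grad Γ ψ) (s • grad Γ φ) := by
      unfold gInner
      congr 1
      refine Finset.sum_congr rfl fun i _ => Finset.sum_congr rfl fun j _ => ?_
      rw [mul_right_comm, hgv, Matrix.smul_apply, smul_eq_mul]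
      ring
    rw [h1, gInner_smul_right, gInner_grad hg hμP _ (isSkew_grad Γ φ), mul_neg, Finset.mul_sum]
    congr 1
    exact Finset.sum_congr rfl fun i _ => by ring
  have hadm : IsAdmissible Γ g μ (μ - s • d) (fun t => τ (κ t)) v :=
    { continuousOn := (hτc.comp hκc).continuousOn
      mem := fun t _ => hτP _ (hκmem t)
      skew := fun t => by
        ext i j
        simp only [hv, Matrix.transpose_apply, Matrix.neg_apply, Matrix.of_apply,
          (isSkew_grad Γ φ).apply i j, hg.symm _ (hIcc t j) _ (hIcc t i),
          hg.symm _ (mem_Icc_of_mem_Prob hμP j) _ (mem_Icc_of_mem_Prob hμP i)]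
        ring
      measurable := fun i j => (hvc i j).measurable
      integrable := fun i j _ => ((hgc i j).mul (hvc i j)).integrableOn_Icc
      start := by simp only [hκeq 0 ⟨le_rfl, zero_le_one⟩, ← hτ0]
      finish := by simp only [hκeq 1 ⟨zero_le_one, le_rfl⟩, ← hτ1]
      continuity := by
        intro ψ hψ
        simp only [hκeq 0 ⟨le_rfl, zero_le_one⟩, hκeq 1 ⟨zero_le_one, le_rfl⟩, hinner]
        have hψi : ∀ t i, HasDerivAt (fun r => ψ r i) (deriv ψ t i) t := fun t i =>
          hasDerivAt_pi.1 ((hψ.differentiable (by simp)) t).hasDerivAt i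
        have hτi : ∀ t i, HasDerivAt (fun r => τ r i) (-(s * d i)) t := fun t i => by
          simpa [hτ] using ((hasDerivAt_id t).mul_const (s * d i)).const_sub (μ i)
        have hderiv : ∀ t, HasDerivAt (fun r => ∑ i, ψ r i * τ r i)
            (∑ i, (deriv ψ t i * τ t i + ψ t i * -(s * d i))) t := fun t =>
          HasDerivAt.fun_sum fun i _ => (hψi t i).mul (hτi t i)
        have hψc : Continuous (deriv ψ) := hψ.continuous_deriv le_rfl
        have hint : Continuous fun t => ∑ i, (deriv ψ t i * τ t i + ψ t i * -(s * d i)) := by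
          have := hψ.continuous
          fun_prop
        have hftc := intervalIntegral.integral_eq_sub_of_hasDerivAt (a := 0) (b := 1)
          (fun t _ => hderiv t) (hint.intervalIntegrable _ _)
        rw [← hftc, sub_eq_zero]
        refine intervalIntegral.integral_congr fun t ht => ?_
        rw [uIcc_of_le zero_le_one] at ht
        simp only [hκeq t ht, Finset.sum_add_distrib, mul_neg, Finset.sum_neg_distrib] }
  refine ⟨hτ1 ▸ hτP 1 ⟨zero_le_one, le_rfl⟩, ?_⟩
  have hS : 0 ≤ (1 / 2) * ∑ i, ∑ j, (grad Γ φ i j) ^ 2 / (m / 2) :=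
    mul_nonneg (by norm_num) (Finset.sum_nonneg fun i _ => Finset.sum_nonneg fun j _ => by
      positivity)
  have hbound : ∀ t, gNorm Γ g (τ (κ t)) (v t) ^ 2 ≤
      (c * s) ^ 2 := by
    intro t
    rw [gNorm, Real.sq_sqrt (gInner_self_nonneg hg (hτP _ (hκmem t)) _), mul_pow c,
      hc, Real.sq_sqrt hS, gInner, mul_assoc, Finset.sum_mul]
    refine mul_le_mul_of_nonneg_left (Finset.sum_le_sum fun i _ => ?_) (by norm_num)
    rw [Finset.sum_mul]
    refine (Finset.sum_le_sum fun j _ => ?_).trans (Finset.sum_le_sum_of_subset_of_nonneg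
      (f := fun j => (grad Γ φ i j) ^ 2 / (m / 2) * s ^ 2) (Finset.filter_subset _ _)
      fun j _ _ => by positivity)
    have hg0 := hg.nonneg (mem_Icc_of_mem_Prob hμP i) (mem_Icc_of_mem_Prob hμP j)
    have hg1 := hg.le_one (mem_Icc_of_mem_Prob hμP i) (mem_Icc_of_mem_Prob hμP j)
    rw [hgv]
    simp only [hv, Matrix.of_apply]
    rw [show s * g (μ i) (μ j) * grad Γ φ i j *
      (s * g (μ i) (μ j) * grad Γ φ i j / g (τ (κ t) i) (τ (κ t) j)) =
      (g (μ i) (μ j) ^ 2 * ((grad Γ φ i j) ^ 2 * s ^ 2)) / g (τ (κ t) i) (τ (κ t) j) by ring,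
      div_mul_eq_mul_div]
    refine div_le_div₀ (by positivity) ?_ (half_pos hm) (hglb t i j)
    exact mul_le_of_le_one_left (by positivity) (pow_le_one₀ hg0 hg1)
  have hCs : 0 ≤ c * s :=
    mul_nonneg (Real.sqrt_nonneg _) hs.1.le
  rw [wasserstein, one_div, ENNReal.rpow_inv_le_iff two_pos,
    ENNReal.ofReal_rpow_of_nonneg hCs zero_le_two]
  refine iInf_le_of_le (fun t => τ (κ t)) (iInf_le_of_le v (iInf_le_of_le hadm ?_))
  calc ∫⁻ t in Icc (0 : ℝ) 1, ENNReal.ofReal (gNorm Γ g (τ (κ t)) (v t) ^ 2)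
      ≤ ∫⁻ _ in Icc (0 : ℝ) 1, ENNReal.ofReal
        ((c * s) ^ 2) :=
        lintegral_mono fun t => ENNReal.ofReal_le_ofReal (hbound t)
    _ = _ := by
        rw [lintegral_const, Measure.restrict_apply_univ, Real.volume_Icc, sub_zero,
          ENNReal.ofReal_one, mul_one, Real.rpow_two]

/-- Two Wasserstein gradients at a positive vector have the same inner product with any graph
gradient. -/
theorem gInner_eq_of_isWassersteinGradient (hg : IsMetricTensor g) {F : (Fin n → ℝ) → ℝ}
    {μ : Fin n → ℝ} (hμ : μ ∈ PosProb n) {p q : Matrix (Fin n) (Fin n) ℝ}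
    (hp : IsWassersteinGradient Γ g F μ p) (hq : IsWassersteinGradient Γ g F μ q)
    (φ : Fin n → ℝ) : gInner Γ g μ p (grad Γ φ) = gInner Γ g μ q (grad Γ φ) := by
  obtain ⟨C, hC, s₀, hs₀, hW⟩ := exists_wasserstein_le (Γ := Γ) hg hμ φ
  have key : ∀ p, IsWassersteinGradient Γ g F μ p → ∀ ε : ℝ, 0 < ε → ∀ᶠ s in 𝓝[>] (0 : ℝ),
      |F (μ - s • GraphHJ.div Γ g μ (grad Γ φ)) - F μ - s * gInner Γ g μ p (grad Γ φ)| ≤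
        ε * (C * s) := by
    rintro p ⟨-, c, -, hc⟩ ε hε
    obtain ⟨δ, hδ, h⟩ := hc ε hε
    have hlim : Tendsto (fun s : ℝ => l1Norm (μ - s • GraphHJ.div Γ g μ (grad Γ φ) - μ))
        (𝓝[>] 0) (𝓝 0) := by
      have hcont : Continuous fun s : ℝ =>
          l1Norm (μ - s • GraphHJ.div Γ g μ (grad Γ φ) - μ) := by
        simp only [l1Norm, Pi.sub_apply, Pi.smul_apply, smul_eq_mul]
        fun_prop
      have := hcont.tendsto 0
      simp only [zero_smul, sub_zero, sub_self] at this
      simpa [l1Norm] using this.mono_left nhdsWithin_le_nhds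
    filter_upwards [Ioo_mem_nhdsGT hs₀, hlim.eventually_lt_const hδ] with s hs hsδ
    obtain ⟨hP, hWs⟩ := hW s hs
    -- For v' = s ∇_G φ the residual ρ' - μ + div v' is exactly zero, so only ε 𝒲 ≤ ε C s remains.
    have h1 := h _ hP (grad Γ (s • φ)) (isTangent_grad _ _ _ _) hsδ
    rw [grad_smul, graphDiv_smul, gInner_smul_right] at h1
    have e : μ - s • GraphHJ.div Γ g μ (grad Γ φ) - μ + s • GraphHJ.div Γ g μ (grad Γ φ) = 0 := by
      abel
    rw [e] at h1
    simp only [l1Norm, Pi.zero_apply, abs_zero, Finset.sum_const_zero, mul_zero,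
      ENNReal.ofReal_zero, add_zero] at h1
    have h2 := h1.trans (mul_le_mul_right hWs _)
    rw [← ENNReal.ofReal_mul hε.le] at h2
    exact (ENNReal.ofReal_le_ofReal_iff (by have := hs.1; positivity)).1 h2
  by_contra hne
  have hpos := abs_pos.2 (sub_ne_zero.2 hne)
  -- With this ε the two estimates give s|a - b| ≤ 2ε C s ≤ s|a - b|/2 for the two inner products a
  -- and b, a contradiction.
  have hε : 0 < |gInner Γ g μ p (grad Γ φ) - gInner Γ g μ q (grad Γ φ)| / (4 * (C + 1)) := by
    positivity
  obtain ⟨s, ⟨hs1, hs2⟩, hs0⟩ :=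
    (((key p hp _ hε).and (key q hq _ hε)).and self_mem_nhdsWithin).exists
  replace hs0 : (0 : ℝ) < s := hs0
  generalize gInner Γ g μ p (grad Γ φ) = a at *
  generalize gInner Γ g μ q (grad Γ φ) = b at *
  have h1 : |s * (a - b)| ≤ 2 * (|a - b| / (4 * (C + 1)) * (C * s)) := by
    rw [abs_le] at hs1 hs2 ⊢
    constructor <;> linarith [hs1.1, hs1.2, hs2.1, hs2.2]
  rw [abs_mul, abs_of_pos hs0] at h1
  have h2 : |a - b| / (4 * (C + 1)) * C ≤ |a - b| / 4 := by
    rw [div_mul_eq_mul_div, div_le_div_iff₀ (by positivity) (by norm_num)]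
    nlinarith
  nlinarith

/-- The noise operator on skew matrices at positive vectors. -/
theorem noise_eq_neg_gInner (hg : IsMetricTensor g) {μ : Fin n → ℝ} (hμ : μ ∈ PosProb n)
    {p : Matrix (Fin n) (Fin n) ℝ} (hp : IsSkew p) :
    noise Γ g μ p = -gInner Γ g μ p (grad Γ fun i => Real.log (μ i)) := by
  rw [gInner_comm, gInner_grad hg hμ.1 _ hp, neg_neg, noise]
  exact Finset.sum_congr rfl fun i _ => mul_comm _ _

theorem noiseExt_eq_noise (hg : IsMetricTensor g) {μ : Fin n → ℝ} (hμ : μ ∈ PosProb n)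
    {p : Matrix (Fin n) (Fin n) ℝ} (hp : IsSkew p) : noiseExt Γ g μ p = noise Γ g μ p := by
  rw [noise_eq_neg_gInner hg hμ hp, noiseExt, gInner]
  congr 2
  refine Finset.sum_congr rfl fun i _ => Finset.sum_congr rfl fun j _ => ?_
  rw [gBar_of_pos hg ⟨hμ.2 i, (mem_Icc_of_mem_Prob hμ.1 i).2⟩
    ⟨hμ.2 j, (mem_Icc_of_mem_Prob hμ.1 j).2⟩]
  simp only [grad, Matrix.of_apply]
  ring

end Wasserstein

/-! ### The Fréchet derivative of u and the main theorem. -/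

section Main

variable {n : ℕ}

/-- If the increment of `F` at `μ` is a factor continuous at `μ` applied to the increment of the
variable, then this factor gives the Fréchet derivative. -/
theorem hasFrechetDeriv_of_increment_factor [Nonempty (Fin n)] {F : (Fin n → ℝ) → ℝ}
    {μ : Fin n → ℝ} (hμ : μ ∈ Prob n) {L : (Fin n → ℝ) → (Fin n → ℝ) →L[ℝ] ℝ}
    (hL : ContinuousWithinAt L (Prob n) μ) (hF : ∀ ν ∈ Prob n, F ν - F μ = L ν (ν - μ)) :
    HasFrechetDeriv F
      (fun i => L μ (Pi.single i 1) - (∑ k, L μ (Pi.single k 1)) / n) μ := by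
  have hn : (n : ℝ) ≠ 0 := by
    have := Fin.pos_iff_nonempty.2 (inferInstance : Nonempty (Fin n))
    exact_mod_cast this.ne'
  refine ⟨by simp [Finset.sum_sub_distrib, mul_div_cancel₀ _ hn], fun ρ' hρ' => ?_⟩
  have hconv : Convex ℝ (Prob n) := convex_stdSimplex ℝ (Fin n)
  have hline : HasDerivWithinAt (fun t : ℝ => μ + t • (ρ' - μ)) (ρ' - μ) (Icc 0 1) 0 := by
    simpa using (((hasDerivAt_id (0 : ℝ)).smul_const (ρ' - μ)).const_add μ).hasDerivWithinAt
  have hmaps : MapsTo (fun t : ℝ => μ + t • (ρ' - μ)) (Icc 0 1) (Prob n) := fun t ht =>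
    hconv.add_smul_sub_mem hμ hρ' ht
  have e0 : μ + (0 : ℝ) • (ρ' - μ) = μ := by simp
  have hd := hasDerivWithinAt_of_increment_factor hline
    (f := fun t => F (μ + t • (ρ' - μ))) (L := fun t => L (μ + t • (ρ' - μ)))
    (ContinuousWithinAt.comp_of_eq (t := Prob n) hL hline.continuousWithinAt hmaps e0)
    fun r hr => by rw [e0]; exact hF _ (hmaps hr)
  simp only [e0] at hd
  rw [hasDerivWithinAt_iff_tendsto_slope, Icc_sdiff_left, nhdsWithin_Ioc_eq_nhdsGT one_pos] at hd
  -- Subtracting the mean normalizes the derivative to sum zero; it does not affect the pairing with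
  -- ρ' - μ, whose entries sum to zero.
  have e1 : ∑ i, (L μ (Pi.single i 1) - (∑ k, L μ (Pi.single k 1)) / n) * (ρ' i - μ i) =
      L μ (ρ' - μ) := by
    rw [clm_apply_eq_sum (L μ) (ρ' - μ)]
    simp only [sub_mul, Finset.sum_sub_distrib, ← Finset.mul_sum, Pi.sub_apply, hρ'.2, hμ.2,
      sub_self, mul_zero, sub_zero]
  rw [e1]
  refine hd.congr fun t => ?_
  rw [slope_def_field, sub_zero, zero_smul, add_zero]
  congr 3
  rw [smul_sub, sub_smul, one_smul]
  abel

theorem grad_sub_const (Γ : WeightedGraph n) (f : Fin n → ℝ) (c : ℝ) :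
    (grad Γ fun i => f i - c) = grad Γ f := by
  ext i j
  simp [grad]

/-- A continuous function on a product of a subset with itself and of `ℝ`, extended by zero. -/
theorem exists_continuousOn_extension_zero {X V : Type*} [TopologicalSpace X] [TopologicalSpace V]
    [Zero V] {P : Set X} {H : P × P → ℝ → V} (hH : Continuous (Function.uncurry H)) :
    ∃ L : ℝ → X → X → V, ContinuousOn (fun q : ℝ × X × X => L q.1 q.2.1 q.2.2) (univ ×ˢ P ×ˢ P) ∧
      ∀ (t : ℝ) (a b : P), L t a b = H (a, b) t := by
  classical
  refine ⟨fun t a b => if h : a ∈ P ∧ b ∈ P then H (⟨a, h.1⟩, ⟨b, h.2⟩) t else 0, ?_,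
    fun t a b => dif_pos ⟨a.2, b.2⟩⟩
  rw [continuousOn_iff_continuous_domRestrict]
  have hc : Continuous fun q : ↥((univ : Set ℝ) ×ˢ P ×ˢ P) =>
      H (⟨q.1.2.1, q.2.2.1⟩, ⟨q.1.2.2, q.2.2.2⟩) q.1.1 := by
    refine hH.comp (f := fun q : ↥((univ : Set ℝ) ×ˢ P ×ˢ P) =>
      (((⟨q.1.2.1, q.2.2.1⟩ : P), (⟨q.1.2.2, q.2.2.2⟩ : P)), q.1.1)) ?_
    exact ((Continuous.subtype_mk (by fun_prop) _).prodMk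
      (Continuous.subtype_mk (by fun_prop) _)).prodMk (by fun_prop)
  convert! hc using 1
  funext q
  exact dif_pos ⟨q.2.2.1, q.2.2.2⟩

end Main

theorem mainTheorem1 {n : ℕ} (Γ : WeightedGraph n) (g : ℝ → ℝ → ℝ) (hg : IsMetricTensor g)
    (hg_zero : ∀ s ∈ Icc (0 : ℝ) 1, ∀ t ∈ Icc (0 : ℝ) 1, s * t = 0 → g s t = 0)
    (hgBar : ContinuousOn (Function.uncurry (gBar g)) (Icc 0 1 ×ˢ Icc 0 1))
    (hxi_lip : ∃ K, LipschitzOnWith K (xi Γ g) (Prob n))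
    (hxi_C1 : ContDiffOn ℝ 1 (xi Γ g) (Prob n)) :
    ∃ σ : ℝ → (Fin n → ℝ) → (Fin n → ℝ),
      -- `σ` is the flow of `ξ` on the probability vectors
      (∀ μ ∈ Prob n, IsSolution Γ g (Ici 0) μ (fun t => σ t μ)) ∧
      (∀ μ ∈ Prob n, ∀ T : ℝ, 0 < T → ∀ s : ℝ → Fin n → ℝ, IsSolution Γ g (Icc 0 T) μ s →
        EqOn s (fun t => σ t μ) (Icc 0 T)) ∧
      ∀ u₀ : (Fin n → ℝ) → ℝ, FrechetC1 u₀ →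
        ∃ (ut : ℝ → (Fin n → ℝ) → ℝ) (Du : ℝ → (Fin n → ℝ) → Fin n → ℝ),
          -- `u(t,μ) = u₀(σ(t,μ))` is continuously differentiable
          IsC1With (fun t μ => u₀ (σ t μ)) ut Du ∧
          -- the initial condition
          (∀ μ ∈ Prob n, u₀ (σ 0 μ) = u₀ μ) ∧
          -- the equation `∂ₜ u = Δ_ind u` on all probability vectors
          (∀ t ∈ Ici (0 : ℝ), ∀ μ ∈ Prob n,
            IsWassersteinGradient Γ g (fun ν => u₀ (σ t ν)) μ (grad Γ (Du t μ)) ∧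
            ut t μ = noiseExt Γ g μ (grad Γ (Du t μ))) ∧
          -- at positive vectors, with the Wasserstein gradient and no extension
          (∀ t ∈ Ici (0 : ℝ), ∀ μ ∈ PosProb n, ∀ p : Matrix (Fin n) (Fin n) ℝ,
            IsWassersteinGradient Γ g (fun ν => u₀ (σ t ν)) μ p → ut t μ = noise Γ g μ p) := by
  have hne : Nonempty (Fin n) := Γ.connected.nonempty
  obtain ⟨K, hK⟩ := hxi_lip
  have hPc : IsCompact (Prob n) := isCompact_stdSimplex ℝ (Fin n)
  obtain ⟨σ, hσ⟩ := exists_flow_of_inward hPc (convex_stdSimplex ℝ (Fin n)) hK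
    (h := 1 / ((K : ℝ) + 1)) (by have := K.2; positivity)
    fun μ hμ => add_smul_xi_mem Γ hg hgBar hK hμ
  refine ⟨σ, fun μ hμ => ⟨(hσ μ hμ).2.1, (hσ μ hμ).1, (hσ μ hμ).2.2⟩,
    fun μ hμ T _ s hs t ht => ?_, fun u₀ hu₀ => ?_⟩
  · have := dist_solution_le hK (r := s) (s := fun t => σ t μ) hs.mem
      (fun r hr => (hσ μ hμ).2.1 r hr.1) hs.ode
      (fun r hr => ((hσ μ hμ).2.2 r hr.1).mono Icc_subset_Ici_self) t ht
    simp only [hs.initial, (hσ μ hμ).1, dist_self, zero_mul] at this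
    exact dist_le_zero.1 this
  obtain ⟨G, C, hG, hGC, hGf⟩ := exists_increment_factor_of_contDiffOn hxi_C1
  obtain ⟨D, hD, hDf⟩ := hu₀.exists_increment_factor
  obtain ⟨H, hH, hHf⟩ := exists_comp_flow_increment_factor hPc hK hσ hG hGC hGf hD hDf
  obtain ⟨L, hLc, hLH⟩ := exists_continuousOn_extension_zero hH
  have hLf : ∀ t ∈ Ici (0 : ℝ), ∀ μ ∈ Prob n, ∀ ν ∈ Prob n,
      u₀ (σ t ν) - u₀ (σ t μ) = L t μ ν (ν - μ) := fun t ht μ hμ ν hν => by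
    rw [hLH t ⟨μ, hμ⟩ ⟨ν, hν⟩]
    exact hHf ⟨μ, hμ⟩ ⟨ν, hν⟩ t ht
  have hLcont : ∀ t, ∀ μ ∈ Prob n, ContinuousOn (L t μ) (Prob n) := fun t μ hμ =>
    hLc.comp (f := fun ν => (t, μ, ν)) (by fun_prop) fun ν hν => ⟨mem_univ _, hμ, hν⟩
  have hLdiag : ContinuousOn (fun q : ℝ × (Fin n → ℝ) => L q.1 q.2 q.2) (Ici 0 ×ˢ Prob n) :=
    hLc.comp (f := fun q : ℝ × (Fin n → ℝ) => (q.1, q.2, q.2)) (by fun_prop)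
      fun q hq => ⟨mem_univ _, hq.2, hq.2⟩
  have hσc := continuousOn_flow hPc hK hσ
  have htime : ∀ t ∈ Ici (0 : ℝ), ∀ μ ∈ Prob n, HasDerivWithinAt (fun r => u₀ (σ r μ))
      (D (σ t μ, σ t μ) (xi Γ g (σ t μ))) (Ici 0) t := by
    intro t ht μ hμ
    have hs := (hσ μ hμ).2.2 t ht
    exact hasDerivWithinAt_of_increment_factor (L := fun r => D (σ t μ, σ r μ)) hs
      (hD.continuousAt.comp_continuousWithinAt
        (continuousWithinAt_const.prodMk hs.continuousWithinAt))
      fun r hr => hDf _ ((hσ μ hμ).2.1 t ht) _ ((hσ μ hμ).2.1 r hr)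
  have hgradW : ∀ t ∈ Ici (0 : ℝ), ∀ μ ∈ Prob n,
      IsWassersteinGradient Γ g (fun ν => u₀ (σ t ν)) μ
        (grad Γ fun i => L t μ μ (Pi.single i 1)) := fun t ht μ hμ =>
    isWassersteinGradient_grad hg hμ (hLcont t μ hμ μ hμ) (hLf t ht μ hμ)
  -- The function r ↦ u(t + r, μ) = u(t, σ_r μ) is differentiated at r = 0 in two ways: in time, and
  -- through the factor `L` along the trajectory leaving μ with velocity ξ(μ).
  have heq : ∀ t ∈ Ici (0 : ℝ), ∀ μ ∈ Prob n, D (σ t μ, σ t μ) (xi Γ g (σ t μ)) =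
      noiseExt Γ g μ (grad Γ fun i => L t μ μ (Pi.single i 1)) := by
    intro t ht μ hμ
    rw [noiseExt_grad Γ hg hgBar hμ, ← clm_apply_eq_sum]
    have h0 := (hσ μ hμ).1
    have hs := (hσ μ hμ).2.2 0 (mem_Ici.2 le_rfl)
    have h1 : HasDerivWithinAt (fun r => u₀ (σ (r + t) μ))
        (D (σ t μ, σ t μ) (xi Γ g (σ t μ))) (Ici 0) 0 := by
      have e : HasDerivWithinAt (fun r : ℝ => r + t) 1 (Ici 0) 0 :=
        ((hasDerivAt_id (0 : ℝ)).add_const t).hasDerivWithinAt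
      have := HasDerivWithinAt.scomp_of_eq (0 : ℝ) (htime t ht μ hμ) e
        (fun r hr => add_nonneg hr.out ht.out) (zero_add t).symm
      rwa [one_smul] at this
    have h2 : HasDerivWithinAt (fun r => u₀ (σ t (σ r μ))) (L t μ (σ 0 μ) (xi Γ g (σ 0 μ)))
        (Ici 0) 0 :=
      hasDerivWithinAt_of_increment_factor (L := fun r => L t μ (σ r μ)) hs
        (ContinuousWithinAt.comp_of_eq (t := Prob n) (hLcont t μ hμ μ hμ) hs.continuousWithinAt
          (fun r hr => (hσ μ hμ).2.1 r hr) h0)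
        fun r hr => by
          rw [h0]
          exact hLf t ht μ hμ _ ((hσ μ hμ).2.1 r hr)
    rw [h0] at h2
    refine (uniqueDiffOn_Ici (0 : ℝ) 0 (mem_Ici.2 le_rfl)).eq_deriv _ h1 (h2.congr_of_mem ?_
      (mem_Ici.2 le_rfl))
    intro r hr
    simp only [flow_add hK hσ hμ ht.out hr.out]
  refine ⟨fun t μ => D (σ t μ, σ t μ) (xi Γ g (σ t μ)),
    fun t μ i => L t μ μ (Pi.single i 1) - (∑ k, L t μ μ (Pi.single k 1)) / n,
    ⟨htime, fun t ht μ hμ => hasFrechetDeriv_of_increment_factor hμ (hLcont t μ hμ μ hμ)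
      (hLf t ht μ hμ), ?_, ?_⟩, fun μ hμ => by rw [(hσ μ hμ).1], fun t ht μ hμ => ?_,
    fun t ht μ hμ p hp => ?_⟩
  · exact (hD.comp_continuousOn (hσc.prodMk hσc)).clm_apply
      (hK.continuousOn.comp hσc fun q hq => (hσ q.2 hq.2).2.1 q.1 hq.1)
  · refine continuousOn_pi.2 fun i => ContinuousOn.sub (hLdiag.clm_apply continuousOn_const) ?_
    exact (continuousOn_finsetSum _ fun k _ => hLdiag.clm_apply continuousOn_const).div_const _
  · rw [grad_sub_const]
    exact ⟨hgradW t ht μ hμ, heq t ht μ hμ⟩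
  -- Both noise terms are negative inner products with ∇_G log μ, on which any two Wasserstein
  -- gradients agree.
  · change D (σ t μ, σ t μ) (xi Γ g (σ t μ)) = _
    rw [heq t ht μ hμ.1, noiseExt_eq_noise hg hμ (isSkew_grad _ _),
      noise_eq_neg_gInner hg hμ (isSkew_grad _ _), noise_eq_neg_gInner hg hμ hp.1.1,
      gInner_eq_of_isWassersteinGradient hg hμ hp (hgradW t ht μ hμ.1)]
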